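/- Let $F=(F_1,F_2)$ be a holomorphic automorphism of $\mathbb C^2$ whose germ at the origin has the form $$F(z,w)=\bigl(z+z^2+O(z^3,z^2w),\; w-zw^2+O(z^4,z^3w,z^2w^2,zw^3)\bigr),$$ where $O(m_1,\dots,m_k)$ denotes a term bounded near $0$ by a constant times $|m_1|+\dots+|m_k|$. For $\varepsilon>0$ let $V_\varepsilon=\{z\in\mathbb C: 0<|z|<\varepsilon,\ |\mathrm{Arg}(z)-\pi|<\pi/8\}$, with $\mathrm{Arg}\in[0,2\pi)$. Call $\gamma$ a parabolic curve for $F$ on $V_\varepsilon$ if $\gamma$ is holomorphic in $V_\varepsilon$ and continuous on $\overline{V_\varepsilon}$, $\gamma(0)=0$, the graph $\mathcal C=\mathcal C_\varepsilon=\{(z,\gamma(z)): z\in V_\varepsilon\}$ satisfies $F(\mathcal C)\subset\mathcal C$ and $F^n(p)\to 0$ for every $p\in\mathcal C$, and there are constants $C_1,C_2$ with $|\gamma(z)|\le C_1|z|^3$ and $|\gamma'(z)|\le C_2|z|^2$ for $z\in V_\varepsilon$. Given such $\gamma$, put $$D=D_\varepsilon=\{(z,w): z\in V_\varepsilon,\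 w-\gamma(z)\in V_\varepsilon,\ |z|<|w-\gamma(z)|\},\qquad \Gamma=\bigcup_{n\ge0}F^{-n}(\mathcal C),\qquad \Omega=\bigcup_{n\ge0}F^{-n}(D).$$ Then a parabolic curve for $F$ exists on $V_{\varepsilon_1}$ for some $\varepsilon_1>0$. Moreover, if $\gamma$ is any parabolic curve for $F$ on $V_{\varepsilon_1}$, with $\varepsilon_1>0$, then there is $\varepsilon_0\in(0,\varepsilon_1]$ such that for every $0<\varepsilon\le\varepsilon_0$ the restriction of $\gamma$ is a parabolic curve for $F$ on $V_\varepsilon$, and the corresponding sets satisfy: 1. $F(\Gamma)=\Gamma$; 2. $\Gamma$ is biholomorphic to $\mathbb C$, where the complex structure of $\Gamma$ is given by the local parametrizations $z\mapsto F^{-n}(z,\gamma(z))$, $z\in V_\varepsilon$, $n\ge 0$; 3. $\Gamma\subset\partial\Omega$. -/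

import Mathlib

open Filter Topology Asymptotics

/-- A holomorphic automorphism `F` of `ℂ²` whose expansion at the origin is
`F(z,w) = (z + z² + O(z³, z²w), w - zw² + O(z⁴, z³w, z²w², zw³))`.
In particular `F(0) = 0` and `F` is tangent to the identity at the origin. -/
structure IsDegenerateAutomorphism (F : ℂ × ℂ ≃ ℂ × ℂ) : Prop where
  holo : Differentiable ℂ F
  holo_symm : Differentiable ℂ F.symm
  expansion_fst :
    (fun p : ℂ × ℂ => (F p).1 - (p.1 + p.1 ^ 2)) =O[𝓝 0]
      fun p => ‖p.1‖ ^ 3 + ‖p.1‖ ^ 2 * ‖p.2‖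
  expansion_snd :
    (fun p : ℂ × ℂ => (F p).2 - (p.2 - p.1 * p.2 ^ 2)) =O[𝓝 0]
      fun p => ‖p.1‖ ^ 4 + ‖p.1‖ ^ 3 * ‖p.2‖ + ‖p.1‖ ^ 2 * ‖p.2‖ ^ 2 + ‖p.1‖ * ‖p.2‖ ^ 3

/-- The sector `V_ε = {z : 0 < |z| < ε, |Arg z - π| < π/8}`, where `Arg` takes values in `[0, 2π)`.
As `Complex.arg` takes values in `(-π, π]`, the angular condition reads `|arg (-z)| < π/8`. -/
def sector (ε : ℝ) : Set ℂ :=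
  {z | 0 < ‖z‖ ∧ ‖z‖ < ε ∧ |Complex.arg (-z)| < Real.pi / 8}

/-- The curve `C = {(z, γ(z)) : z ∈ V_ε}`. -/
def graphCurve (γ : ℂ → ℂ) (ε : ℝ) : Set (ℂ × ℂ) :=
  (fun z => (z, γ z)) '' sector ε

/-- The graph of `γ` over `V_ε` is a parabolic curve for `F`, attracted to the origin along
`(1,0)`: `γ` is holomorphic in `V_ε` and continuous on its closure, `γ(0) = 0`, the graph over `V_ε`
is mapped into itself, its points are attracted to the origin, and `γ(z) = O(z³)`,
`γ'(z) = O(z²)` on `V_ε`. -/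
structure IsParabolicCurve (F : ℂ × ℂ ≃ ℂ × ℂ) (γ : ℂ → ℂ) (ε : ℝ) : Prop where
  holo : DifferentiableOn ℂ γ (sector ε)
  cont : ContinuousOn γ (closure (sector ε))
  zero : γ 0 = 0
  invariant : Set.MapsTo F (graphCurve γ ε) (graphCurve γ ε)
  attracted : ∀ p ∈ graphCurve γ ε, Tendsto (fun n : ℕ => F^[n] p) atTop (𝓝 0)
  size : ∃ C₁ : ℝ, ∀ z ∈ sector ε, ‖γ z‖ ≤ C₁ * ‖z‖ ^ 3
  size_deriv : ∃ C₂ : ℝ, ∀ z ∈ sector ε, ‖deriv γ z‖ ≤ C₂ * ‖z‖ ^ 2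

/-- The region `D = {(z,w) : z ∈ V_ε, w - γ(z) ∈ V_ε, |z| < |w - γ(z)|}`. -/
def localDomain (γ : ℂ → ℂ) (ε : ℝ) : Set (ℂ × ℂ) :=
  {p | p.1 ∈ sector ε ∧ p.2 - γ p.1 ∈ sector ε ∧ ‖p.1‖ < ‖p.2 - γ p.1‖}

/-- `⋃_{n ≥ 0} F^{-n}(S)`. -/
def backwardSaturation (F : ℂ × ℂ ≃ ℂ × ℂ) (S : Set (ℂ × ℂ)) : Set (ℂ × ℂ) :=
  ⋃ n : ℕ, F^[n] ⁻¹' S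

/-- The curve `Γ = ⋃ F^{-n}(C)`. -/
def bigCurve (F : ℂ × ℂ ≃ ℂ × ℂ) (γ : ℂ → ℂ) (ε : ℝ) : Set (ℂ × ℂ) :=
  backwardSaturation F (graphCurve γ ε)

/-- The basin `Ω = ⋃ F^{-n}(D)`. -/
def basin (F : ℂ × ℂ ≃ ℂ × ℂ) (γ : ℂ → ℂ) (ε : ℝ) : Set (ℂ × ℂ) :=
  backwardSaturation F (localDomain γ ε)

/-- `Γ = ⋃ F^{-n}(C)` is biholomorphic to `ℂ`: there is a holomorphic bijection `h` of `ℂ` onto `Γ`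
whose inverse `Φ` is holomorphic on `Γ`, that is, in each of the local parametrizations
`z ↦ F^{-n}(z, γ(z))`, `z ∈ V_ε`, which together cover `Γ`. -/
def BigCurveBiholomorphicToPlane (F : ℂ × ℂ ≃ ℂ × ℂ) (γ : ℂ → ℂ) (ε : ℝ) : Prop :=
  ∃ (h : ℂ → ℂ × ℂ) (Φ : ℂ × ℂ → ℂ),
    Differentiable ℂ h ∧ Set.range h = bigCurve F γ ε ∧ (∀ t, Φ (h t) = t) ∧
      ∀ n : ℕ, DifferentiableOn ℂ (fun z => Φ (F.symm^[n] (z, γ z))) (sector ε)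

/-!
In the coordinate `U = -1/z` the first component of `F` becomes `U ↦ U + 1 + k(z, w)`, with
`k = O(|z| + |w|)` Lipschitz in `(z, w)`, and the second component is
`w ↦ w - z w² + z β(z, w)` with `β` of order three. Besides holomorphy, only these bounds enter
(`exists_localBounds`); they follow from the expansion of `F` by Cauchy estimates, carried out
in each variable separately.

*Existence.* The curve is found by Perron's method. For fixed `U` with large real part, an orbit
tending to the origin is a fixed point of an operator on sequences which sums the deviations of
`U_n` from `U + n` forwards from `0` and the second coordinates `w_n` backwards from infinity. In
suitable weights this operator halves distances (`WithinDist.perron`), so it has exactly one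
admissible fixed point; `γ` is its entry `w_0`. Uniqueness gives invariance, uniform convergence of
the iterates gives holomorphy, and since `γ` is defined on a whole half-plane of `U`, the bound for
`γ'` on the smaller sector is Cauchy's estimate.

*Uniformization.* On the curve, `F` acts as `g(U) = U + 1 + κ(U)`, where `κ` and its difference
quotients decay. Hence `φ(U) = lim (gⁿ U - gⁿ U₀)` converges, conjugates `g` to the unit translation
and satisfies `|φ(U) - φ(V) - (U - V)| ≤ |U - V| / 2`
(`IsPerturbedTranslation.exists_fatou`). The last bound makes `φ` injective with holomorphic inverse
and makes its image contain discs of half the radius; as orbits enter the cone ever more deeply, the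
translates `φ(U) - n` fill the plane. Thus `F⁻ⁿ(z, γ z) ↦ φ(-1/z) - n` is the required
uniformization of `Γ`.

*Boundary.* For `v = w - γ z` one has `v ↦ v - z v² + O(|z| |v| (|z| + |v|)²)`
(`CurveControl.offset_step`). If `|v| ≤ |z|`, then `v` changes by the factor `1 + O(|z|²)`, which is
summable along orbits: an orbit starting at offset `-δ` keeps its offset near `-δ` until
`|z| < |v|`, and at that moment it is in `D`. So the curve is in the closure of `Ω`. If `|z| < |v|`, then
`Y = -1/v` moves to `Y - z (1 + small)`; as `-z` lies in a cone narrower than the cone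
`|Im Y| < Re Y`, the points of `D` stay in a forward invariant region on which `v ≠ 0`
(`CurveControl.mapsTo_escapeRegion`). So `Γ` and `Ω` are disjoint. The region `D` itself need not be
invariant, which is why the wider cone is used.
-/

/-! ### Cauchy estimates and the local form of the map -/

theorem norm_sub_le_of_bounded_ball {q : ℂ → ℂ} {ρ B : ℝ} (hρ : 0 < ρ)
    (hq : DifferentiableOn ℂ q (Metric.ball 0 (3 * ρ)))
    (hB : ∀ z ∈ Metric.ball (0 : ℂ) (3 * ρ), ‖q z‖ ≤ B) {z z' : ℂ}
    (hz : ‖z‖ ≤ ρ) (hz' : ‖z'‖ ≤ ρ) : ‖q z - q z'‖ ≤ B / ρ * ‖z - z'‖ := by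
  have hsub : ∀ x ∈ Metric.closedBall (0 : ℂ) ρ,
      Metric.closedBall x ρ ⊆ Metric.ball (0 : ℂ) (3 * ρ) := by
    intro x hx
    apply Metric.closedBall_subset_ball'
    rw [Metric.mem_closedBall] at hx
    linarith
  refine (convex_closedBall (0 : ℂ) ρ).norm_image_sub_le_of_norm_deriv_le (f := q) (x := z')
    (y := z) (C := B / ρ) ?_ ?_ (by simpa using hz') (by simpa using hz)
  · intro x hx
    exact hq.differentiableAt (Metric.isOpen_ball.mem_nhds
      (hsub x hx (Metric.mem_closedBall_self hρ.le)))
  · intro x hx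
    refine Complex.norm_deriv_le_of_forall_mem_sphere_norm_le hρ ?_ fun y hy =>
      hB y (hsub x hx (Metric.sphere_subset_closedBall hy))
    exact (hq.mono (hsub x hx)).diffContOnCl_ball subset_rfl

/-- The centre may be removed from the disc, since a bounded holomorphic function extends
over it. -/
theorem norm_sub_le_of_bounded_punctured_ball {q : ℂ → ℂ} {ρ B : ℝ} (hρ : 0 < ρ)
    (hq : DifferentiableOn ℂ q (Metric.ball 0 (3 * ρ) \ {0}))
    (hB : ∀ z ∈ Metric.ball (0 : ℂ) (3 * ρ) \ {0}, ‖q z‖ ≤ B) {z z' : ℂ}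
    (hz0 : z ≠ 0) (hz0' : z' ≠ 0)
    (hz : ‖z‖ ≤ ρ) (hz' : ‖z'‖ ≤ ρ) : ‖q z - q z'‖ ≤ B / ρ * ‖z - z'‖ := by
  have hnhds : Metric.ball (0 : ℂ) (3 * ρ) ∈ 𝓝 (0 : ℂ) := Metric.ball_mem_nhds _ (by positivity)
  have hd := Complex.differentiableOn_update_limUnder_of_bddAbove hnhds hq
    ⟨B, by rintro _ ⟨x, hx, rfl⟩; exact hB x hx⟩
  set Q := Function.update q 0 (limUnder (𝓝[≠] 0) q) with hQ
  have hQne : ∀ x, x ≠ 0 → Q x = q x := fun x hx => Function.update_of_ne hx _ _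
  have hQ0 : ‖Q 0‖ ≤ B := by
    have hc : Tendsto (fun x => ‖Q x‖) (𝓝[≠] 0) (𝓝 ‖Q 0‖) :=
      ((hd.differentiableAt hnhds).continuousAt.tendsto.mono_left nhdsWithin_le_nhds).norm
    refine le_of_tendsto hc ?_
    filter_upwards [self_mem_nhdsWithin, mem_nhdsWithin_of_mem_nhds hnhds] with x hx hx'
    rw [hQne x hx]
    exact hB x ⟨hx', hx⟩
  have := norm_sub_le_of_bounded_ball hρ hd (B := B) (fun x hx => ?_) hz hz'
  · rwa [hQne z hz0, hQne z' hz0'] at this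
  · by_cases h : x = 0
    · rw [h]; exact hQ0
    · rw [hQne x h]; exact hB x ⟨hx, h⟩

/-- The relative error `α` of the first component, `F₁ = z + z² (1 + α)`. -/
noncomputable def fstError (F : ℂ × ℂ ≃ ℂ × ℂ) (z w : ℂ) : ℂ :=
  ((F (z, w)).1 - (z + z ^ 2)) / z ^ 2

/-- The error `β` of the second component, `F₂ = w - z w² + z β`. -/
noncomputable def sndError (F : ℂ × ℂ ≃ ℂ × ℂ) (z w : ℂ) : ℂ :=
  ((F (z, w)).2 - (w - z * w ^ 2)) / z

/-- The deviation of the first component from a unit translation in the coordinate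
`U = -1/z`: the coordinate `U` is mapped to `U + 1 + shiftError F z w`. -/
noncomputable def shiftError (F : ℂ × ℂ ≃ ℂ × ℂ) (z w : ℂ) : ℂ :=
  -1 / (F (z, w)).1 + 1 / z - 1

/-- Bounds for the errors of `F` on the bidisc of radius `r`, punctured along `z = 0`. -/
structure LocalBounds (F : ℂ × ℂ ≃ ℂ × ℂ) (M r : ℝ) : Prop where
  one_le : 1 ≤ M
  pos : 0 < r
  le_one : r ≤ 1
  fst_ne : ∀ z w : ℂ, z ≠ 0 → ‖z‖ ≤ r → ‖w‖ ≤ r → (F (z, w)).1 ≠ 0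
  shift_bound : ∀ z w : ℂ, z ≠ 0 → ‖z‖ ≤ r → ‖w‖ ≤ r → ‖shiftError F z w‖ ≤ M * (‖z‖ + ‖w‖)
  shift_lip : ∀ z w z' w' : ℂ, z ≠ 0 → z' ≠ 0 → ‖z‖ ≤ r → ‖w‖ ≤ r → ‖z'‖ ≤ r → ‖w'‖ ≤ r →
    ‖shiftError F z w - shiftError F z' w'‖ ≤ M * (‖z - z'‖ + ‖w - w'‖)
  fst_lip : ∀ z w w' : ℂ, z ≠ 0 → ‖z‖ ≤ r → ‖w‖ ≤ r → ‖w'‖ ≤ r →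
    ‖(F (z, w)).1 - (F (z, w')).1‖ ≤ M * ‖z‖ ^ 2 * ‖w - w'‖
  snd_bound : ∀ ρ ≤ r, ∀ z w : ℂ, z ≠ 0 → ‖z‖ ≤ ρ → ‖w‖ ≤ ρ → ‖sndError F z w‖ ≤ M * ρ ^ 3
  snd_lip : ∀ ρ ≤ r, ∀ z w z' w' : ℂ, z ≠ 0 → z' ≠ 0 → ‖z‖ ≤ ρ → ‖w‖ ≤ ρ → ‖z'‖ ≤ ρ → ‖w'‖ ≤ ρ →
    ‖sndError F z w - sndError F z' w'‖ ≤ M * ρ ^ 2 * (‖z - z'‖ + ‖w - w'‖)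

theorem snd_eq (F : ℂ × ℂ ≃ ℂ × ℂ) {z : ℂ} (w : ℂ) (hz : z ≠ 0) :
    (F (z, w)).2 = w + (-(z * w ^ 2) + z * sndError F z w) := by
  unfold sndError; field_simp; ring

theorem fst_eq (F : ℂ × ℂ ≃ ℂ × ℂ) {z : ℂ} (w : ℂ) (hz : z ≠ 0) :
    (F (z, w)).1 = z * (1 + z * (1 + fstError F z w)) := by
  unfold fstError; field_simp; ring

theorem shift_eq (F : ℂ × ℂ ≃ ℂ × ℂ) (z w : ℂ) :
    -1 / (F (z, w)).1 = -1 / z + 1 + shiftError F z w := by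
  unfold shiftError; ring

theorem exists_localBounds {F : ℂ × ℂ ≃ ℂ × ℂ} (hF : IsDegenerateAutomorphism F) :
    ∃ M r : ℝ, LocalBounds F M r := by
  obtain ⟨c₁, hc₁⟩ := hF.expansion_fst.bound
  obtain ⟨c₂, hc₂⟩ := hF.expansion_snd.bound
  obtain ⟨s, hs, hball⟩ := Metric.eventually_nhds_iff_ball.1 (hc₁.and hc₂)
  obtain ⟨c, hc1, hcc₁, hcc₂⟩ : ∃ c : ℝ, 1 ≤ c ∧ c₁ ≤ c ∧ c₂ ≤ c :=
    ⟨max 1 (max c₁ c₂), le_max_left _ _, (le_max_left _ _).trans (le_max_right _ _),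
      (le_max_right _ _).trans (le_max_right _ _)⟩
  have hmem : ∀ z w : ℂ, ‖z‖ < s → ‖w‖ < s → (z, w) ∈ Metric.ball (0 : ℂ × ℂ) s := by
    intro z w hz hw
    simpa [Prod.norm_def] using ⟨hz, hw⟩
  have hα : ∀ z w : ℂ, z ≠ 0 → ‖z‖ < s → ‖w‖ < s → ‖fstError F z w‖ ≤ c * (‖z‖ + ‖w‖) := by
    intro z w hz hzs hws
    have h := (hball _ (hmem z w hzs hws)).1
    have hz' : 0 < ‖z‖ := norm_pos_iff.2 hz
    unfold fstError
    rw [norm_div, norm_pow, div_le_iff₀ (by positivity)]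
    refine h.trans ?_
    rw [Real.norm_of_nonneg (by positivity)]
    calc c₁ * (‖z‖ ^ 3 + ‖z‖ ^ 2 * ‖w‖) ≤ c * (‖z‖ ^ 3 + ‖z‖ ^ 2 * ‖w‖) := by gcongr
      _ = _ := by ring
  have hβ : ∀ z w : ℂ, z ≠ 0 → ‖z‖ < s → ‖w‖ < s →
      ‖sndError F z w‖ ≤ c * (‖z‖ ^ 3 + ‖z‖ ^ 2 * ‖w‖ + ‖z‖ * ‖w‖ ^ 2 + ‖w‖ ^ 3) := by
    intro z w hz hzs hws
    have h := (hball _ (hmem z w hzs hws)).2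
    have hz' : 0 < ‖z‖ := norm_pos_iff.2 hz
    unfold sndError
    rw [norm_div, div_le_iff₀ (by positivity)]
    refine h.trans ?_
    rw [Real.norm_of_nonneg (by positivity)]
    refine (mul_le_mul_of_nonneg_right hcc₂ (by positivity)).trans_eq ?_
    ring
  have hFz : ∀ w : ℂ, Differentiable ℂ fun z : ℂ => F (z, w) := fun w =>
    hF.holo.comp (differentiable_id.prodMk (differentiable_const w))
  have hFw : ∀ z : ℂ, Differentiable ℂ fun w : ℂ => F (z, w) := fun z =>
    hF.holo.comp ((differentiable_const z).prodMk differentiable_id)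
  have hαz : ∀ (w : ℂ) (ρ : ℝ), DifferentiableOn ℂ (fun z => fstError F z w)
      (Metric.ball 0 ρ \ {0}) := by
    intro w ρ z hz
    have hz0 : z ≠ 0 := hz.2
    refine DifferentiableAt.differentiableWithinAt ?_
    unfold fstError
    have := (hFz w z).fst
    fun_prop (disch := simpa using hz0)
  have hβz : ∀ (w : ℂ) (ρ : ℝ), DifferentiableOn ℂ (fun z => sndError F z w)
      (Metric.ball 0 ρ \ {0}) := by
    intro w ρ z hz
    have hz0 : z ≠ 0 := hz.2
    refine DifferentiableAt.differentiableWithinAt ?_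
    unfold sndError
    have := (hFz w z).snd
    fun_prop (disch := simpa using hz0)
  have hαw : ∀ (z : ℂ), Differentiable ℂ (fun w => fstError F z w) := by
    intro z w
    unfold fstError
    have := (hFw z w).fst
    fun_prop
  have hβw : ∀ (z : ℂ), Differentiable ℂ (fun w => sndError F z w) := by
    intro z w
    unfold sndError
    have := (hFw z w).snd
    fun_prop
  -- Lipschitz bounds for both errors, one variable at a time
  have hα_lip : ∀ ρ, 0 < ρ → 3 * ρ ≤ s → ∀ z w z' w' : ℂ, z ≠ 0 → z' ≠ 0 → ‖z‖ ≤ ρ → ‖w‖ ≤ ρ →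
      ‖z'‖ ≤ ρ → ‖w'‖ ≤ ρ →
      ‖fstError F z w - fstError F z' w'‖ ≤ 6 * c * (‖z - z'‖ + ‖w - w'‖) := by
    intro ρ hρ hρs z w z' w' hz hz' hzρ hwρ hzρ' hwρ'
    have h1 := norm_sub_le_of_bounded_punctured_ball (B := c * (3 * ρ + 3 * ρ)) hρ
      (hαz w (3 * ρ)) (fun x hx => ?_) hz hz' hzρ hzρ'
    · have h2 := norm_sub_le_of_bounded_ball (B := c * (3 * ρ + 3 * ρ)) hρ
        (hαw z').differentiableOn (fun x hx => ?_) hwρ hwρ'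
      · have e : c * (3 * ρ + 3 * ρ) / ρ = 6 * c := by field_simp; ring
        rw [e] at h1 h2
        have := norm_sub_le_norm_sub_add_norm_sub (fstError F z w) (fstError F z' w)
          (fstError F z' w')
        linarith
      · rw [mem_ball_zero_iff] at hx
        refine (hα z' x hz' (by linarith) (by linarith)).trans ?_
        gcongr
        linarith
    · have hx1 := mem_ball_zero_iff.1 hx.1
      refine (hα x w hx.2 (by linarith) (by linarith)).trans ?_
      gcongr
      linarith
  have hβ_lip : ∀ ρ, 0 < ρ → 3 * ρ ≤ s → ∀ z w z' w' : ℂ, z ≠ 0 → z' ≠ 0 → ‖z‖ ≤ ρ → ‖w‖ ≤ ρ →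
      ‖z'‖ ≤ ρ → ‖w'‖ ≤ ρ →
      ‖sndError F z w - sndError F z' w'‖ ≤ 108 * c * ρ ^ 2 * (‖z - z'‖ + ‖w - w'‖) := by
    intro ρ hρ hρs z w z' w' hz hz' hzρ hwρ hzρ' hwρ'
    have hb : ∀ a b : ℂ, a ≠ 0 → ‖a‖ < 3 * ρ → ‖b‖ < 3 * ρ → ‖sndError F a b‖ ≤
        c * ((3 * ρ) ^ 3 + (3 * ρ) ^ 2 * (3 * ρ) + (3 * ρ) * (3 * ρ) ^ 2 + (3 * ρ) ^ 3) := by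
      intro a b ha hal hbl
      refine (hβ a b ha (by linarith) (by linarith)).trans ?_
      gcongr
    have h1 := norm_sub_le_of_bounded_punctured_ball hρ
      (hβz w (3 * ρ)) (fun x hx => hb x w hx.2 (by simpa using hx.1) (by linarith)) hz hz' hzρ hzρ'
    have h2 := norm_sub_le_of_bounded_ball hρ
        (hβw z').differentiableOn (fun x hx => hb z' x hz' (by linarith) (by simpa using hx))
        hwρ hwρ'
    have e : c * ((3 * ρ) ^ 3 + (3 * ρ) ^ 2 * (3 * ρ) + (3 * ρ) * (3 * ρ) ^ 2 + (3 * ρ) ^ 3) / ρ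
        = 108 * c * ρ ^ 2 := by field_simp; ring
    rw [e] at h1 h2
    have := norm_sub_le_norm_sub_add_norm_sub (sndError F z w) (sndError F z' w)
      (sndError F z' w')
    linarith
  obtain ⟨r, hr, hr1, hr2, hr3⟩ : ∃ r : ℝ, 0 < r ∧ r ≤ 1 / 4 ∧ 3 * r ≤ s ∧ c * (2 * r) ≤ 1 := by
    refine ⟨min (1 / 4) (min (s / 3) (1 / (2 * c))), by positivity, min_le_left _ _, ?_, ?_⟩
    · have := (min_le_right (1 / 4 : ℝ) (min (s / 3) (1 / (2 * c)))).trans (min_le_left _ _)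
      linarith
    · have := (min_le_right (1 / 4 : ℝ) (min (s / 3) (1 / (2 * c)))).trans (min_le_right _ _)
      rw [le_div_iff₀ (by positivity)] at this
      linarith
  -- on this bidisc the relative error is at most one
  have hα1 : ∀ z w : ℂ, z ≠ 0 → ‖z‖ ≤ r → ‖w‖ ≤ r → ‖1 + fstError F z w‖ ≤ 2 := by
    intro z w hz hzr hwr
    have h := hα z w hz (by linarith) (by linarith)
    have h' : c * (‖z‖ + ‖w‖) ≤ c * (2 * r) := by gcongr; linarith
    have := norm_add_le 1 (fstError F z w)
    rw [norm_one] at this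
    linarith
  have hD : ∀ z w : ℂ, z ≠ 0 → ‖z‖ ≤ r → ‖w‖ ≤ r →
      1 / 2 ≤ ‖1 + z * (1 + fstError F z w)‖ := by
    intro z w hz hzr hwr
    have h := hα1 z w hz hzr hwr
    have h1 : ‖z * (1 + fstError F z w)‖ ≤ 1 / 4 * 2 := by
      rw [norm_mul]; gcongr; linarith
    have := norm_sub_norm_le 1 (-(z * (1 + fstError F z w)))
    rw [norm_neg, sub_neg_eq_add, norm_one] at this
    linarith
  have hD0 : ∀ z w : ℂ, z ≠ 0 → ‖z‖ ≤ r → ‖w‖ ≤ r → 1 + z * (1 + fstError F z w) ≠ 0 := by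
    intro z w hz hzr hwr h
    have := hD z w hz hzr hwr
    rw [h, norm_zero] at this
    norm_num at this
  have hshift : ∀ z w : ℂ, z ≠ 0 → ‖z‖ ≤ r → ‖w‖ ≤ r →
      shiftError F z w = (1 + fstError F z w) / (1 + z * (1 + fstError F z w)) - 1 := by
    intro z w hz hzr hwr
    have := hD0 z w hz hzr hwr
    unfold shiftError
    rw [fst_eq F w hz]
    field_simp
    ring
  refine ⟨108 * c, r, by linarith, hr, by linarith, ?_, ?_, ?_, ?_, ?_, ?_⟩
  · intro z w hz hzr hwr
    rw [fst_eq F w hz]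
    exact mul_ne_zero hz (hD0 z w hz hzr hwr)
  · intro z w hz hzr hwr
    have h0 := hD0 z w hz hzr hwr
    have e : shiftError F z w = (fstError F z w - z * (1 + fstError F z w)) /
        (1 + z * (1 + fstError F z w)) := by
      rw [hshift z w hz hzr hwr, div_sub_one h0]; congr 1; ring
    rw [e, norm_div, div_le_iff₀ (norm_pos_iff.2 h0)]
    have h1 := norm_sub_le (fstError F z w) (z * (1 + fstError F z w))
    have h2 : ‖z * (1 + fstError F z w)‖ ≤ ‖z‖ * 2 := by
      rw [norm_mul]; gcongr; exact hα1 z w hz hzr hwr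
    have h3 := hα z w hz (by linarith) (by linarith)
    have h4 : 108 * c * (‖z‖ + ‖w‖) * (1 / 2) ≤
        108 * c * (‖z‖ + ‖w‖) * ‖1 + z * (1 + fstError F z w)‖ := by
      gcongr; exact hD z w hz hzr hwr
    nlinarith [norm_nonneg z, norm_nonneg w]
  · intro z w z' w' hz hz' hzr hwr hzr' hwr'
    have h0 := hD0 z w hz hzr hwr
    have h0' := hD0 z' w' hz' hzr' hwr'
    have hL := hα_lip r hr hr2 z w z' w' hz hz' hzr hwr hzr' hwr'
    have ha := hα1 z w hz hzr hwr
    have ha' := hα1 z' w' hz' hzr' hwr'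
    have hd := hD z w hz hzr hwr
    have hd' := hD z' w' hz' hzr' hwr'
    rw [hshift z w hz hzr hwr, hshift z' w' hz' hzr' hwr']
    set a := fstError F z w
    set a' := fstError F z' w'
    have e : (1 + a) / (1 + z * (1 + a)) - 1 - ((1 + a') / (1 + z' * (1 + a')) - 1) =
        ((a - a') + (1 + a) * (1 + a') * (z' - z)) / ((1 + z * (1 + a)) * (1 + z' * (1 + a'))) := by
      rw [sub_sub_sub_cancel_right, div_sub_div _ _ h0 h0']; congr 1; ring
    rw [e, norm_div, norm_mul, div_le_iff₀ (by positivity)]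
    have h1 : ‖(a - a') + (1 + a) * (1 + a') * (z' - z)‖ ≤ 6 * c * (‖z - z'‖ + ‖w - w'‖) +
        2 * 2 * ‖z - z'‖ := by
      refine (norm_add_le _ _).trans ?_
      rw [norm_mul, norm_mul, norm_sub_rev z' z]
      gcongr
    have h2 : 108 * c * (‖z - z'‖ + ‖w - w'‖) * (1 / 2 * (1 / 2)) ≤
        108 * c * (‖z - z'‖ + ‖w - w'‖) * (‖1 + z * (1 + a)‖ * ‖1 + z' * (1 + a')‖) := by gcongr
    nlinarith [norm_nonneg (z - z'), norm_nonneg (w - w')]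
  · intro z w w' hz hzr hwr hwr'
    have hL := hα_lip r hr hr2 z w z w' hz hz hzr hwr hzr hwr'
    rw [fst_eq F w hz, fst_eq F w' hz]
    have e : z * (1 + z * (1 + fstError F z w)) - z * (1 + z * (1 + fstError F z w')) =
      z ^ 2 * (fstError F z w - fstError F z w') := by ring
    rw [e, norm_mul, norm_pow]
    rw [sub_self, norm_zero, zero_add] at hL
    calc ‖z‖ ^ 2 * ‖fstError F z w - fstError F z w'‖ ≤ ‖z‖ ^ 2 * (6 * c * ‖w - w'‖) := by gcongr
      _ ≤ ‖z‖ ^ 2 * (108 * c * ‖w - w'‖) := by gcongr; norm_num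
      _ = _ := by ring
  · intro ρ hρ z w hz hzρ hwρ
    refine (hβ z w hz (by linarith) (by linarith)).trans ?_
    have hρ0 : 0 ≤ ρ := (norm_nonneg _).trans hzρ
    calc c * (‖z‖ ^ 3 + ‖z‖ ^ 2 * ‖w‖ + ‖z‖ * ‖w‖ ^ 2 + ‖w‖ ^ 3)
        ≤ c * (ρ ^ 3 + ρ ^ 2 * ρ + ρ * ρ ^ 2 + ρ ^ 3) := by gcongr
      _ = 4 * c * ρ ^ 3 := by ring
      _ ≤ _ := by gcongr; norm_num
  · intro ρ hρ z w z' w' hz hz' hzρ hwρ hzρ' hwρ'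
    exact hβ_lip ρ ((norm_pos_iff.2 hz).trans_le hzρ) (by linarith) z w z' w' hz hz' hzρ hwρ
      hzρ' hwρ'

/-! ### Sums of inverse powers -/

theorem sum_inv_sq_le {N : ℝ} (hN : 1 ≤ N) (n : ℕ) :
    ∑ j ∈ Finset.range n, 1 / (N + j) ^ 2 ≤ 2 / N := by
  have key : ∑ j ∈ Finset.range n, 1 / (N + j) ^ 2 ≤ 2 / N - 2 / (N + n) := by
    induction n with
    | zero => simp
    | succ n ih =>
      rw [Finset.sum_range_succ]
      have hx : 1 ≤ N + n := by have : (0 : ℝ) ≤ n := n.cast_nonneg; linarith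
      have hstep : 1 / (N + n) ^ 2 ≤ 2 / (N + n) - 2 / (N + n + 1) := by
        rw [div_sub_div _ _ (by positivity) (by positivity),
          div_le_div_iff₀ (by positivity) (by positivity)]
        nlinarith
      push_cast
      rw [← add_assoc]
      linarith
  have : 0 ≤ 2 / (N + n) := by positivity
  linarith

theorem summable_of_norm_le_inv_pow_four {N c : ℝ} (hN : 1 ≤ N) {g : ℕ → ℂ}
    (hg : ∀ j : ℕ, ‖g j‖ ≤ c / (N + j) ^ 4) : Summable g ∧ ‖∑' j, g j‖ ≤ 2 * c / N ^ 3 := by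
  have hN0 : 0 < N := by linarith
  have hc : 0 ≤ c := by
    have := (norm_nonneg _).trans (hg 0)
    rw [le_div_iff₀ (by positivity)] at this
    simpa using this
  have hle : ∀ n, ∑ j ∈ Finset.range n, ‖g j‖ ≤ 2 * c / N ^ 3 := by
    intro n
    calc ∑ j ∈ Finset.range n, ‖g j‖ ≤ ∑ j ∈ Finset.range n, c / N ^ 2 * (1 / (N + j) ^ 2) := by
          refine Finset.sum_le_sum fun j _ => (hg j).trans ?_
          rw [div_mul_div_comm, mul_one]
          have hj : N ≤ N + j := by simp
          gcongr
          calc N ^ 2 * (N + j) ^ 2 ≤ (N + j) ^ 2 * (N + j) ^ 2 := by gcongr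
            _ = _ := by ring
      _ ≤ c / N ^ 2 * (2 / N) := by
          rw [← Finset.mul_sum]; gcongr; exact sum_inv_sq_le hN n
      _ = _ := by field_simp
  have hs := summable_of_sum_range_le (fun j => norm_nonneg (g j)) hle
  exact ⟨hs.of_norm, (norm_tsum_le_tsum_norm hs).trans
    (Real.tsum_le_of_sum_range_le (fun j => norm_nonneg _) hle)⟩

/-! ### The Perron operator on orbits -/

/-- The increment `F₂ - w` of the second component. -/
noncomputable def sndStep (F : ℂ × ℂ ≃ ℂ × ℂ) (z w : ℂ) : ℂ :=
  -(z * w ^ 2) + z * sndError F z w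

/-- The first coordinate `z = -1/(U + n + u n)` of the `n`-th point of a candidate orbit, where
`u n` is the deviation from the translation orbit of `U`. -/
noncomputable def orbitFst (U : ℂ) (u : ℕ → ℂ) (n : ℕ) : ℂ := -1 / (U + n + u n)

/-- First component of the Perron operator: the deviations produced by a candidate orbit. -/
noncomputable def perronFst (F : ℂ × ℂ ≃ ℂ × ℂ) (U : ℂ) (u w : ℕ → ℂ) (n : ℕ) : ℂ :=
  ∑ j ∈ Finset.range n, shiftError F (orbitFst U u j) (w j)

/-- Second component of the Perron operator: the second coordinate is summed backwards
from its limit `0` at infinity. -/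
noncomputable def perronSnd (F : ℂ × ℂ ≃ ℂ × ℂ) (U : ℂ) (u w : ℕ → ℂ) (n : ℕ) : ℂ :=
  -∑' j : ℕ, sndStep F (orbitFst U u (n + j)) (w (n + j))

/-- The candidate orbits on which the Perron operator is a contraction. -/
structure Admissible (U : ℂ) (u w : ℕ → ℂ) : Prop where
  fst : ∀ n : ℕ, ‖u n‖ ≤ n / 10
  snd : ∀ n : ℕ, ‖w n‖ ≤ 2 / (U.re + n) ^ 2

/-- Two candidate orbits are at weighted distance at most `d`. -/
structure WithinDist (U : ℂ) (d : ℝ) (u w u' w' : ℕ → ℂ) : Prop where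
  fst : ∀ n : ℕ, ‖u n - u' n‖ ≤ d * (U.re + n)
  snd : ∀ n : ℕ, ‖w n - w' n‖ ≤ d / (U.re + n) ^ 2

/-- The real part of `U` is so large that all estimates for the Perron operator hold. -/
structure FarRight (M r : ℝ) (U : ℂ) : Prop where
  large : 400 * M ≤ U.re
  radius : 2 ≤ r * U.re

section
variable {F : ℂ × ℂ ≃ ℂ × ℂ} {M r : ℝ} {U : ℂ} {u w u' w' : ℕ → ℂ}

theorem FarRight.le_re (hL : LocalBounds F M r) (hU : FarRight M r U) (n : ℕ) :
    400 ≤ U.re + n := by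
  have := hL.one_le
  have := hU.large
  have : (0 : ℝ) ≤ n := n.cast_nonneg
  linarith

theorem FarRight.two_div_le (hL : LocalBounds F M r) (hU : FarRight M r U) (n : ℕ) :
    2 / (U.re + n) ≤ r := by
  have h := hU.le_re hL n
  have := hU.radius
  have h0 := hL.pos
  have : (0 : ℝ) ≤ r * n := by positivity
  rw [div_le_iff₀ (by linarith)]
  linarith

theorem Admissible.re_ge (ha : Admissible U u w) (n : ℕ) :
    U.re + n - n / 10 ≤ (U + n + u n).re := by
  have h1 := ha.fst n
  have h2 := (Complex.abs_re_le_norm (u n)).trans h1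
  have h3 := (abs_le.1 h2).1
  simp only [Complex.add_re, Complex.natCast_re]
  linarith

theorem Admissible.half_le (hL : LocalBounds F M r) (hU : FarRight M r U)
    (ha : Admissible U u w) (n : ℕ) : (U.re + n) / 2 ≤ ‖U + n + u n‖ := by
  have h1 := ha.re_ge n
  have h2 := Complex.re_le_norm (U + n + u n)
  have h3 := hU.le_re hL 0
  have : (0 : ℝ) ≤ n := n.cast_nonneg
  simp only [Nat.cast_zero, add_zero] at h3
  linarith

theorem Admissible.ne_zero (hL : LocalBounds F M r) (hU : FarRight M r U)
    (ha : Admissible U u w) (n : ℕ) : U + n + u n ≠ 0 := by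
  have h1 := ha.half_le hL hU n
  have h2 := hU.le_re hL n
  exact norm_pos_iff.1 (by linarith)

theorem Admissible.orbitFst_ne (hL : LocalBounds F M r) (hU : FarRight M r U)
    (ha : Admissible U u w) (n : ℕ) : orbitFst U u n ≠ 0 :=
  div_ne_zero (by simp) (ha.ne_zero hL hU n)

theorem Admissible.orbitFst_le (hL : LocalBounds F M r) (hU : FarRight M r U)
    (ha : Admissible U u w) (n : ℕ) : ‖orbitFst U u n‖ ≤ 2 / (U.re + n) := by
  have h1 := ha.half_le hL hU n
  have h2 := hU.le_re hL n
  unfold orbitFst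
  rw [norm_div, norm_neg, norm_one, div_le_div_iff₀ (by linarith) (by linarith)]
  linarith

theorem Admissible.snd_le (hL : LocalBounds F M r) (hU : FarRight M r U)
    (ha : Admissible U u w) (n : ℕ) : ‖w n‖ ≤ 2 / (U.re + n) := by
  have h2 := hU.le_re hL n
  refine (ha.snd n).trans ?_
  have : (U.re + n) ≤ (U.re + n) ^ 2 := by nlinarith
  gcongr

theorem Admissible.shift_le (hL : LocalBounds F M r) (hU : FarRight M r U)
    (ha : Admissible U u w) (n : ℕ) :
    ‖shiftError F (orbitFst U u n) (w n)‖ ≤ 4 * M / (U.re + n) ∧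
    ‖shiftError F (orbitFst U u n) (w n)‖ ≤ 1 / 10 := by
  have h2 := hU.le_re hL n
  have hr := hU.two_div_le hL n
  have hz := ha.orbitFst_le hL hU n
  have hw := ha.snd_le hL hU n
  have hM := hL.one_le
  have h := hL.shift_bound _ _ (ha.orbitFst_ne hL hU n) (hz.trans hr) (hw.trans hr)
  have h1 : ‖shiftError F (orbitFst U u n) (w n)‖ ≤ 4 * M / (U.re + n) := by
    refine h.trans ?_
    calc M * (‖orbitFst U u n‖ + ‖w n‖) ≤ M * (2 / (U.re + n) + 2 / (U.re + n)) := by gcongr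
      _ = _ := by ring
  refine ⟨h1, h1.trans ?_⟩
  have := hU.large
  have : (0 : ℝ) ≤ n := n.cast_nonneg
  rw [div_le_div_iff₀ (by linarith) (by norm_num)]
  linarith

theorem Admissible.step_le (hL : LocalBounds F M r) (hU : FarRight M r U)
    (ha : Admissible U u w) (n : ℕ) :
    ‖sndStep F (orbitFst U u n) (w n)‖ ≤ 24 * M / (U.re + n) ^ 4 := by
  have h2 := hU.le_re hL n
  have hr := hU.two_div_le hL n
  have hz := ha.orbitFst_le hL hU n
  have hw := ha.snd_le hL hU n
  have hM := hL.one_le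
  have hb := hL.snd_bound _ hr _ _ (ha.orbitFst_ne hL hU n) hz hw
  have hs : 0 < U.re + n := by linarith
  unfold sndStep
  refine (norm_add_le _ _).trans ?_
  rw [norm_neg, norm_mul, norm_mul, norm_pow]
  calc ‖orbitFst U u n‖ * ‖w n‖ ^ 2 + ‖orbitFst U u n‖ * ‖sndError F (orbitFst U u n) (w n)‖
      ≤ 2 / (U.re + n) * (2 / (U.re + n) ^ 2) ^ 2 +
        2 / (U.re + n) * (M * (2 / (U.re + n)) ^ 3) := by gcongr; exact ha.snd n
    _ = (8 / (U.re + n) + 16 * M) / (U.re + n) ^ 4 := by field_simp; ring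
    _ ≤ _ := by
      gcongr
      have : 8 / (U.re + n) ≤ 8 := by rw [div_le_iff₀ hs]; linarith
      linarith

theorem Admissible.perronSnd_le (hL : LocalBounds F M r) (hU : FarRight M r U)
    (ha : Admissible U u w) (n : ℕ) :
    Summable (fun j : ℕ => sndStep F (orbitFst U u (n + j)) (w (n + j))) ∧
    ‖perronSnd F U u w n‖ ≤ 48 * M / (U.re + n) ^ 3 := by
  have h2 := hU.le_re hL n
  have := summable_of_norm_le_inv_pow_four (N := U.re + n) (c := 24 * M) (by linarith)
    (g := fun j : ℕ => sndStep F (orbitFst U u (n + j)) (w (n + j))) (fun j => by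
      have := ha.step_le hL hU (n + j)
      push_cast at this
      rwa [← add_assoc] at this)
  refine ⟨this.1, ?_⟩
  unfold perronSnd
  rw [norm_neg]
  refine this.2.trans_eq ?_
  ring

theorem Admissible.perron (hL : LocalBounds F M r) (hU : FarRight M r U)
    (ha : Admissible U u w) : Admissible U (perronFst F U u w) (perronSnd F U u w) := by
  constructor
  · intro n
    unfold perronFst
    refine (norm_sum_le _ _).trans ((Finset.sum_le_sum fun j _ =>
      (ha.shift_le hL hU j).2).trans_eq ?_)
    simp [div_eq_mul_inv]
  · intro n
    have h2 := hU.le_re hL n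
    refine (ha.perronSnd_le hL hU n).2.trans ?_
    have := hU.large
    have hM := hL.one_le
    have : (0 : ℝ) ≤ n := n.cast_nonneg
    rw [div_le_div_iff₀ (by positivity) (by positivity)]
    have : 48 * M * (U.re + n) ^ 2 ≤ 2 * (U.re + n) * (U.re + n) ^ 2 :=
      mul_le_mul_of_nonneg_right (by linarith) (by positivity)
    nlinarith

theorem WithinDist.orbitFst_le (hL : LocalBounds F M r) (hU : FarRight M r U)
    (ha : Admissible U u w) (ha' : Admissible U u' w') {d : ℝ}
    (hd : WithinDist U d u w u' w') (n : ℕ) :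
    ‖orbitFst U u n - orbitFst U u' n‖ ≤ 4 * d / (U.re + n) := by
  have h2 := hU.le_re hL n
  have hz := ha.orbitFst_le hL hU n
  have hz' := ha'.orbitFst_le hL hU n
  have e : orbitFst U u n - orbitFst U u' n =
      orbitFst U u n * orbitFst U u' n * (u n - u' n) := by
    have := ha.ne_zero hL hU n
    have := ha'.ne_zero hL hU n
    unfold orbitFst
    field_simp
    ring
  rw [e, norm_mul, norm_mul]
  calc ‖orbitFst U u n‖ * ‖orbitFst U u' n‖ * ‖u n - u' n‖
      ≤ 2 / (U.re + n) * (2 / (U.re + n)) * (d * (U.re + n)) := by gcongr; exact hd.fst n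
    _ = _ := by field_simp; ring

/-- The Perron operator halves weighted distances. -/
theorem WithinDist.perron (hL : LocalBounds F M r) (hU : FarRight M r U)
    (ha : Admissible U u w) (ha' : Admissible U u' w') {d : ℝ}
    (hd : WithinDist U d u w u' w') :
    WithinDist U (d / 2) (perronFst F U u w) (perronSnd F U u w) (perronFst F U u' w')
      (perronSnd F U u' w') := by
  have hM := hL.one_le
  have hlarge := hU.large
  have hd0 : 0 ≤ d := by
    have := (norm_nonneg _).trans (hd.fst 0)
    have h2 := hU.le_re hL 0
    exact nonneg_of_mul_nonneg_left this (by linarith)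
  constructor
  · intro n
    have hN : (0 : ℝ) < U.re := by linarith
    have hterm : ∀ j ∈ Finset.range n, ‖shiftError F (orbitFst U u j) (w j) -
        shiftError F (orbitFst U u' j) (w' j)‖ ≤ 5 * M * d / U.re := by
      intro j _
      have h2 := hU.le_re hL j
      have hj : (0 : ℝ) ≤ j := j.cast_nonneg
      have hr := hU.two_div_le hL j
      refine (hL.shift_lip _ _ _ _ (ha.orbitFst_ne hL hU j) (ha'.orbitFst_ne hL hU j)
        ((ha.orbitFst_le hL hU j).trans hr) ((ha.snd_le hL hU j).trans hr)
        ((ha'.orbitFst_le hL hU j).trans hr) ((ha'.snd_le hL hU j).trans hr)).trans ?_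
      have h1 := hd.orbitFst_le hL hU ha ha' j
      have h3 : ‖w j - w' j‖ ≤ d / (U.re + j) := by
        refine (hd.snd j).trans ?_
        have : (U.re + j) ≤ (U.re + j) ^ 2 := by nlinarith
        gcongr
      calc M * (‖orbitFst U u j - orbitFst U u' j‖ + ‖w j - w' j‖)
          ≤ M * (4 * d / (U.re + j) + d / (U.re + j)) := by gcongr
        _ = 5 * M * d / (U.re + j) := by ring
        _ ≤ _ := by gcongr; linarith
    unfold perronFst
    rw [← Finset.sum_sub_distrib]
    refine (norm_sum_le_of_le _ hterm).trans ?_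
    simp only [Finset.sum_const, Finset.card_range, nsmul_eq_mul]
    have hn : (0 : ℝ) ≤ n := n.cast_nonneg
    have : 5 * M * d / U.re ≤ d / 2 := by
      rw [div_le_iff₀ hN]; nlinarith
    calc (n : ℝ) * (5 * M * d / U.re) ≤ (n : ℝ) * (d / 2) := by gcongr
      _ ≤ d / 2 * (U.re + n) := by nlinarith
  · intro n
    have h2 := hU.le_re hL n
    have hterm : ∀ j : ℕ, ‖sndStep F (orbitFst U u (n + j)) (w (n + j)) -
        sndStep F (orbitFst U u' (n + j)) (w' (n + j))‖ ≤ 96 * M * d / (U.re + n + j) ^ 4 := by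
      intro j
      have h2 := hU.le_re hL (n + j)
      have hr := hU.two_div_le hL (n + j)
      have hz := ha.orbitFst_le hL hU (n + j)
      have hz' := ha'.orbitFst_le hL hU (n + j)
      have hw := ha.snd (n + j)
      have hw' := ha'.snd (n + j)
      have hδz := hd.orbitFst_le hL hU ha ha' (n + j)
      have hδw := hd.snd (n + j)
      have hβ := hL.snd_bound _ hr _ _ (ha.orbitFst_ne hL hU (n + j)) hz (ha.snd_le hL hU (n + j))
      have hδβ := hL.snd_lip _ hr _ _ _ _ (ha.orbitFst_ne hL hU (n + j))
        (ha'.orbitFst_ne hL hU (n + j)) hz (ha.snd_le hL hU (n + j)) hz' (ha'.snd_le hL hU (n + j))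
      have es : U.re + n + j = U.re + (n + j : ℕ) := by push_cast; ring
      rw [es]
      set s := U.re + (n + j : ℕ)
      set z := orbitFst U u (n + j)
      set z' := orbitFst U u' (n + j)
      set a := w (n + j)
      set a' := w' (n + j)
      have hs : 0 < s := by linarith
      have e : sndStep F z a - sndStep F z' a' = -((z - z') * a ^ 2) -
          z' * ((a - a') * (a + a')) + (z - z') * sndError F z a +
          z' * (sndError F z a - sndError F z' a') := by unfold sndStep; ring
      have hδw' : ‖a - a'‖ ≤ d / s := by
        refine hδw.trans ?_
        have : s ≤ s ^ 2 := by nlinarith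
        gcongr
      rw [e]
      have b1 : ‖(z - z') * a ^ 2‖ ≤ 4 * d / s * (2 / s ^ 2) ^ 2 := by
        rw [norm_mul, norm_pow]; gcongr
      have b2 : ‖z' * ((a - a') * (a + a'))‖ ≤ 2 / s * (d / s ^ 2 * (2 / s ^ 2 + 2 / s ^ 2)) := by
        rw [norm_mul, norm_mul]; gcongr; exact (norm_add_le _ _).trans (add_le_add hw hw')
      have b3 : ‖(z - z') * sndError F z a‖ ≤ 4 * d / s * (M * (2 / s) ^ 3) := by
        rw [norm_mul]; gcongr
      have b4 : ‖z' * (sndError F z a - sndError F z' a')‖ ≤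
          2 / s * (M * (2 / s) ^ 2 * (4 * d / s + d / s)) := by
        rw [norm_mul]; gcongr
        exact hδβ.trans (by gcongr)
      have tri : ‖-((z - z') * a ^ 2) - z' * ((a - a') * (a + a')) + (z - z') * sndError F z a +
          z' * (sndError F z a - sndError F z' a')‖ ≤ ‖(z - z') * a ^ 2‖ +
          ‖z' * ((a - a') * (a + a'))‖ + ‖(z - z') * sndError F z a‖ +
          ‖z' * (sndError F z a - sndError F z' a')‖ := by
        refine (norm_add_le _ _).trans (add_le_add_left ?_ _)
        refine (norm_add_le _ _).trans (add_le_add_left ?_ _)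
        refine (norm_sub_le _ _).trans ?_
        rw [norm_neg]
      have fin : 4 * d / s * (2 / s ^ 2) ^ 2 + 2 / s * (d / s ^ 2 * (2 / s ^ 2 + 2 / s ^ 2)) +
          4 * d / s * (M * (2 / s) ^ 3) + 2 / s * (M * (2 / s) ^ 2 * (4 * d / s + d / s)) =
          (24 * d / s + 72 * M * d) / s ^ 4 := by field_simp; ring
      refine tri.trans ?_
      refine (add_le_add (add_le_add (add_le_add b1 b2) b3) b4).trans (fin.le.trans ?_)
      gcongr
      have : 24 * d / s ≤ 24 * d := by
        rw [div_le_iff₀ hs]; nlinarith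
      nlinarith
    have := (summable_of_norm_le_inv_pow_four (by linarith) hterm).2
    unfold perronSnd
    rw [neg_sub_neg, norm_sub_rev,
      ← (ha.perronSnd_le hL hU n).1.tsum_sub (ha'.perronSnd_le hL hU n).1]
    refine this.trans ?_
    have hn : (0 : ℝ) ≤ n := n.cast_nonneg
    rw [div_le_div_iff₀ (by positivity) (by positivity)]
    have : 2 * (96 * M * d) * (U.re + n) ^ 2 ≤ d / 2 * (U.re + n) * (U.re + n) ^ 2 :=
      mul_le_mul_of_nonneg_right (by nlinarith) (by positivity)
    nlinarith

theorem Admissible.withinDist (hL : LocalBounds F M r) (hU : FarRight M r U)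
    (ha : Admissible U u w) (ha' : Admissible U u' w') : WithinDist U 4 u w u' w' := by
  constructor
  · intro n
    have h2 := hU.le_re hL n
    have h0 := hU.le_re hL 0
    have hn : (0 : ℝ) ≤ n := n.cast_nonneg
    have := norm_sub_le (u n) (u' n)
    have := ha.fst n
    have := ha'.fst n
    simp only [Nat.cast_zero, add_zero] at h0
    linarith
  · intro n
    have := norm_sub_le (w n) (w' n)
    have := ha.snd n
    have := ha'.snd n
    have e : 4 / (U.re + n) ^ 2 = 2 / (U.re + n) ^ 2 + 2 / (U.re + n) ^ 2 := by ring
    rw [e]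
    linarith

theorem Admissible.snd_unique (hL : LocalBounds F M r) (hU : FarRight M r U)
    (ha : Admissible U u w) (ha' : Admissible U u' w')
    (hu : perronFst F U u w = u) (hw : perronSnd F U u w = w)
    (hu' : perronFst F U u' w' = u') (hw' : perronSnd F U u' w' = w') : w = w' := by
  have key : ∀ m : ℕ, WithinDist U (4 / 2 ^ m) u w u' w' := by
    intro m
    induction m with
    | zero => simpa using ha.withinDist hL hU ha'
    | succ m ih =>
      have := ih.perron hL hU ha ha'
      rw [hu, hw, hu', hw'] at this
      rwa [pow_succ, ← div_div]
  funext n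
  have h2 := hU.le_re hL n
  have hlim : Tendsto (fun m : ℕ => (4 : ℝ) / 2 ^ m / (U.re + n) ^ 2) atTop (𝓝 0) := by
    have := ((tendsto_pow_atTop_nhds_zero_of_lt_one (r := (1 / 2 : ℝ)) (by norm_num)
      (by norm_num)).const_mul 4).div_const ((U.re + n) ^ 2)
    simpa [div_eq_mul_inv] using this
  have := ge_of_tendsto' hlim (fun m => (key m).snd n)
  exact sub_eq_zero.1 (norm_le_zero_iff.1 this)

end

/-! ### The fixed point of the Perron operator -/

/-- The iterates of the Perron operator, started at the zero sequences. -/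
noncomputable def perronIter (F : ℂ × ℂ ≃ ℂ × ℂ) (U : ℂ) : ℕ → (ℕ → ℂ) × (ℕ → ℂ)
  | 0 => (0, 0)
  | m + 1 => (perronFst F U (perronIter F U m).1 (perronIter F U m).2,
      perronSnd F U (perronIter F U m).1 (perronIter F U m).2)

/-- An admissible fixed point of the Perron operator. -/
structure IsPerronFixed (F : ℂ × ℂ ≃ ℂ × ℂ) (U : ℂ) (u w : ℕ → ℂ) : Prop where
  adm : Admissible U u w
  fst : perronFst F U u w = u
  snd : perronSnd F U u w = w

section
variable {F : ℂ × ℂ ≃ ℂ × ℂ} {M r : ℝ} {U : ℂ} {u w u' w' : ℕ → ℂ}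

theorem perronIter_admissible (hL : LocalBounds F M r) (hU : FarRight M r U) (m : ℕ) :
    Admissible U (perronIter F U m).1 (perronIter F U m).2 := by
  induction m with
  | zero =>
    constructor
    · intro n; simp only [perronIter, Pi.zero_apply, norm_zero]; positivity
    · intro n; simp only [perronIter, Pi.zero_apply, norm_zero]; positivity
  | succ m ih => exact ih.perron hL hU

theorem perronIter_withinDist (hL : LocalBounds F M r) (hU : FarRight M r U) (m : ℕ) :
    WithinDist U (4 / 2 ^ m) (perronIter F U m).1 (perronIter F U m).2
      (perronIter F U (m + 1)).1 (perronIter F U (m + 1)).2 := by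
  induction m with
  | zero =>
    simpa using (perronIter_admissible hL hU 0).withinDist hL hU (perronIter_admissible hL hU 1)
  | succ m ih =>
    have := ih.perron hL hU (perronIter_admissible hL hU m) (perronIter_admissible hL hU (m + 1))
    rwa [div_div, ← pow_succ] at this

theorem exists_limit_of_geometric {f : ℕ → ℂ} {c : ℝ}
    (h : ∀ m : ℕ, ‖f m - f (m + 1)‖ ≤ c / 2 ^ m) :
    ∃ l, Tendsto f atTop (𝓝 l) ∧ ∀ m : ℕ, ‖f m - l‖ ≤ 2 * c / 2 ^ m := by
  have h' : ∀ m, dist (f m) (f (m + 1)) ≤ c * (1 / 2) ^ m := by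
    intro m
    rw [dist_eq_norm]
    refine (h m).trans_eq ?_
    rw [one_div, inv_pow, div_eq_mul_inv]
  obtain ⟨l, hl⟩ := cauchySeq_tendsto_of_complete
    (cauchySeq_of_le_geometric (1 / 2) c (by norm_num) h')
  refine ⟨l, hl, fun m => ?_⟩
  have := dist_le_of_le_geometric_of_tendsto (1 / 2) c (by norm_num) h' hl m
  rw [dist_eq_norm] at this
  refine this.trans_eq ?_
  rw [one_div, inv_pow]
  ring

theorem exists_isPerronFixed (hL : LocalBounds F M r) (hU : FarRight M r U) :
    ∃ u w : ℕ → ℂ, IsPerronFixed F U u w ∧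
      ∀ m : ℕ, ‖(perronIter F U m).2 0 - w 0‖ ≤ 8 / 2 ^ m := by
  have h400 := hU.le_re hL
  have h1 : ∀ n : ℕ, ∃ l, Tendsto (fun m => (perronIter F U m).1 n) atTop (𝓝 l) ∧
      ∀ m : ℕ, ‖(perronIter F U m).1 n - l‖ ≤ 2 * (4 * (U.re + n)) / 2 ^ m := fun n =>
    exists_limit_of_geometric fun m => ((perronIter_withinDist hL hU m).fst n).trans_eq (by ring)
  have h2 : ∀ n : ℕ, ∃ l, Tendsto (fun m => (perronIter F U m).2 n) atTop (𝓝 l) ∧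
      ∀ m : ℕ, ‖(perronIter F U m).2 n - l‖ ≤ 2 * (4 / (U.re + n) ^ 2) / 2 ^ m := fun n =>
    exists_limit_of_geometric fun m => ((perronIter_withinDist hL hU m).snd n).trans_eq
      (div_right_comm _ _ _)
  choose u hu hu' using h1
  choose w hw hw' using h2
  have ha : Admissible U u w :=
    ⟨fun n => le_of_tendsto (hu n).norm
      (Eventually.of_forall fun m => (perronIter_admissible hL hU m).fst n),
     fun n => le_of_tendsto (hw n).norm
      (Eventually.of_forall fun m => (perronIter_admissible hL hU m).snd n)⟩
  have hd : ∀ m : ℕ, WithinDist U (8 / 2 ^ m) (perronIter F U m).1 (perronIter F U m).2 u w :=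
    fun m => ⟨fun n => (hu' n m).trans_eq (by ring), fun n => (hw' n m).trans_eq (by ring)⟩
  have hd' : ∀ m : ℕ, WithinDist U (8 / 2 ^ m / 2) (perronIter F U (m + 1)).1
      (perronIter F U (m + 1)).2 (perronFst F U u w) (perronSnd F U u w) := fun m =>
    (hd m).perron hL hU (perronIter_admissible hL hU m) ha
  have hzero : ∀ c : ℝ, Tendsto (fun m : ℕ => 8 / 2 ^ m / 2 * c) atTop (𝓝 0) := by
    intro c
    have := (((tendsto_pow_atTop_nhds_zero_of_lt_one (r := (1 / 2 : ℝ)) (by norm_num)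
      (by norm_num)).const_mul 8).div_const 2).mul_const c
    simpa [div_eq_mul_inv] using this
  refine ⟨u, w, ⟨ha, ?_, ?_⟩, ?_⟩
  · funext n
    refine tendsto_nhds_unique ?_ ((hu n).comp (tendsto_add_atTop_nat 1))
    rw [tendsto_iff_norm_sub_tendsto_zero]
    refine squeeze_zero (fun _ => norm_nonneg _) (fun m => (hd' m).fst n) (hzero _)
  · funext n
    refine tendsto_nhds_unique ?_ ((hw n).comp (tendsto_add_atTop_nat 1))
    rw [tendsto_iff_norm_sub_tendsto_zero]
    refine squeeze_zero (fun _ => norm_nonneg _) (fun m => ((hd' m).snd n).trans_eq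
      (div_eq_mul_inv _ _)) (hzero _)
  · intro m
    refine (hw' 0 m).trans ?_
    have h0 := h400 0
    gcongr
    have : 4 / (U.re + (0 : ℕ)) ^ 2 ≤ 4 := by
      rw [div_le_iff₀ (by positivity)]; nlinarith
    linarith

/-- A fixed point of the Perron operator is an orbit of `F`. -/
theorem IsPerronFixed.map (hL : LocalBounds F M r) (hU : FarRight M r U)
    (h : IsPerronFixed F U u w) (n : ℕ) :
    F (orbitFst U u n, w n) = (orbitFst U u (n + 1), w (n + 1)) := by
  have hz := h.adm.orbitFst_ne hL hU n
  have hu : u (n + 1) = u n + shiftError F (orbitFst U u n) (w n) := by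
    conv_lhs => rw [← h.fst]
    conv_rhs => rw [← h.fst]
    rw [perronFst, Finset.sum_range_succ, ← perronFst, h.fst]
  have hw : w n = w (n + 1) - sndStep F (orbitFst U u n) (w n) := by
    have e1 := congrFun h.snd n
    have e2 := congrFun h.snd (n + 1)
    unfold perronSnd at e1 e2
    rw [(h.adm.perronSnd_le hL hU n).1.tsum_eq_zero_add] at e1
    simp only [add_zero, ← add_assoc, add_right_comm n _ 1] at e1 e2
    rw [← e2]
    linear_combination -e1
  have h1 := shift_eq F (orbitFst U u n) (w n)
  have h2 : -1 / orbitFst U u n = U + n + u n := by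
    have := h.adm.ne_zero hL hU n
    unfold orbitFst; field_simp
  ext1
  · have h3 : -1 / (F (orbitFst U u n, w n)).1 = U + (n + 1 : ℕ) + u (n + 1) := by
      rw [h1, h2, hu]; push_cast; ring
    change (F (orbitFst U u n, w n)).1 = -1 / (U + (n + 1 : ℕ) + u (n + 1))
    rw [← h3]
    field_simp
  · change (F (orbitFst U u n, w n)).2 = w (n + 1)
    rw [snd_eq F _ hz]
    unfold sndStep at hw
    linear_combination hw

theorem IsPerronFixed.re_step (hL : LocalBounds F M r) (hU : FarRight M r U)
    (h : IsPerronFixed F U u w) : ‖u 1‖ ≤ 1 / 10 ∧ FarRight M r (U + 1 + u 1) ∧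
    U.re + 9 / 10 ≤ (U + 1 + u 1).re ∧ (U + 1 + u 1).re ≤ U.re + 11 / 10 := by
  have h1 : ‖u 1‖ ≤ 1 / 10 := by simpa using h.adm.fst 1
  have h2 := abs_le.1 ((Complex.abs_re_le_norm (u 1)).trans h1)
  have h3 : (U + 1 + u 1).re = U.re + 1 + (u 1).re := by simp
  refine ⟨h1, ⟨?_, ?_⟩, ?_, ?_⟩
  · have := hU.large; linarith
  · have := hU.radius
    have := hL.pos
    have h5 : U.re ≤ (U + 1 + u 1).re := by linarith
    have := mul_le_mul_of_nonneg_left h5 this.le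
    linarith
  · linarith
  · linarith

/-- The tail of an orbit is the orbit of its first point. -/
theorem IsPerronFixed.shift (hL : LocalBounds F M r) (hU : FarRight M r U)
    (h : IsPerronFixed F U u w) :
    IsPerronFixed F (U + 1 + u 1) (fun n => u (n + 1) - u 1) (fun n => w (n + 1)) := by
  obtain ⟨h1, hU', hre, hre'⟩ := h.re_step hL hU
  have ho : ∀ n, orbitFst (U + 1 + u 1) (fun n => u (n + 1) - u 1) n = orbitFst U u (n + 1) := by
    intro n; unfold orbitFst; push_cast; congr 1; ring
  have hsum : ∀ n, u n = ∑ j ∈ Finset.range n, shiftError F (orbitFst U u j) (w j) := by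
    intro n; conv_lhs => rw [← h.fst]
    rfl
  have hf : perronFst F (U + 1 + u 1) (fun n => u (n + 1) - u 1) (fun n => w (n + 1)) =
      fun n => u (n + 1) - u 1 := by
    funext n
    unfold perronFst
    simp only [ho]
    rw [hsum (n + 1), hsum 1, Finset.sum_range_succ', Finset.sum_range_one]
    ring
  refine ⟨⟨fun n => ?_, fun n => ?_⟩, hf, ?_⟩
  · rw [← congrFun hf n]
    unfold perronFst
    simp only [ho]
    refine (norm_sum_le _ _).trans ((Finset.sum_le_sum fun j _ =>
      (h.adm.shift_le hL hU (j + 1)).2).trans_eq ?_)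
    simp [div_eq_mul_inv]
  · have hn : (0 : ℝ) ≤ n := n.cast_nonneg
    have h2 := (h.adm.perronSnd_le hL hU (n + 1)).2
    rw [h.snd] at h2
    push_cast at h2
    have h400 := hU.le_re hL n
    have hM := hU.large
    have hM1 := hL.one_le
    have hs : 0 < U.re + (n + 1) := by linarith
    have h6 : 48 * M / (U.re + (n + 1)) ^ 3 ≤ 1 / (U.re + (n + 1)) ^ 2 := by
      rw [div_le_div_iff₀ (by positivity) (by positivity)]
      have := mul_le_mul_of_nonneg_right (show 48 * M ≤ U.re + (n + 1) by linarith)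
        (show 0 ≤ (U.re + (n + 1)) ^ 2 by positivity)
      nlinarith
    refine (h2.trans h6).trans ?_
    have h7 : (0 : ℝ) < (U + 1 + u 1).re + n := by linarith
    rw [div_le_div_iff₀ (by positivity) (by positivity)]
    nlinarith
  · funext n
    conv_rhs => rw [← h.snd]
    unfold perronSnd
    simp only [ho, add_right_comm n _ 1]

end

/-! ### Holomorphic dependence on the initial point -/

section
variable {F : ℂ × ℂ ≃ ℂ × ℂ} {M r : ℝ}

theorem isOpen_re_gt (R : ℝ) : IsOpen {U : ℂ | R < U.re} :=
  isOpen_lt continuous_const Complex.continuous_re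

theorem differentiableAt_shiftError (hF : Differentiable ℂ F) {f g : ℂ → ℂ} {x : ℂ}
    (hf : DifferentiableAt ℂ f x) (hg : DifferentiableAt ℂ g x) (h0 : f x ≠ 0)
    (h1 : (F (f x, g x)).1 ≠ 0) : DifferentiableAt ℂ (fun x => shiftError F (f x) (g x)) x := by
  have h2 : DifferentiableAt ℂ (fun x => F (f x, g x)) x :=
    (hF (f x, g x)).comp x (hf.prodMk hg)
  have h3 := h2.fst
  unfold shiftError
  exact (((differentiableAt_const _).div h3 h1).add ((differentiableAt_const _).div hf h0)).sub
    (differentiableAt_const _)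

theorem differentiableAt_sndStep (hF : Differentiable ℂ F) {f g : ℂ → ℂ} {x : ℂ}
    (hf : DifferentiableAt ℂ f x) (hg : DifferentiableAt ℂ g x) (h0 : f x ≠ 0) :
    DifferentiableAt ℂ (fun x => sndStep F (f x) (g x)) x := by
  have h2 : DifferentiableAt ℂ (fun x => F (f x, g x)) x :=
    (hF (f x, g x)).comp x (hf.prodMk hg)
  have h3 := h2.snd
  unfold sndStep sndError
  exact (hf.mul (hg.pow 2)).neg.add (hf.mul ((h3.sub (hg.sub (hf.mul (hg.pow 2)))).div hf h0))

theorem differentiableOn_perronIter (hF : Differentiable ℂ F) (hL : LocalBounds F M r) {R : ℝ}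
    (hR : ∀ U : ℂ, R < U.re → FarRight M r U) (m n : ℕ) :
    DifferentiableOn ℂ (fun U => (perronIter F U m).1 n) {U | R < U.re} ∧
    DifferentiableOn ℂ (fun U => (perronIter F U m).2 n) {U | R < U.re} := by
  have hR0 : 1 ≤ R := by
    have h1 : ∀ x, R < x → 1 ≤ x := fun x hx => by
      have := (hR (x : ℂ) (by simpa using hx)).large
      have := hL.one_le
      simp only [Complex.ofReal_re] at *
      linarith
    exact le_of_forall_gt_imp_ge_of_dense h1
  induction m generalizing n with
  | zero => exact ⟨differentiableOn_const _, differentiableOn_const _⟩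
  | succ m ih =>
    have hz : ∀ n : ℕ, ∀ U ∈ {U : ℂ | R < U.re},
        DifferentiableAt ℂ (fun U => orbitFst U (perronIter F U m).1 n) U := by
      intro n U hU
      have h1 := (ih n).1.differentiableAt ((isOpen_re_gt R).mem_nhds hU)
      have h2 := (perronIter_admissible hL (hR U hU) m).ne_zero hL (hR U hU) n
      unfold orbitFst
      exact (differentiableAt_const _).div ((differentiableAt_id.add_const _).add h1) h2
    have hw : ∀ n : ℕ, ∀ U ∈ {U : ℂ | R < U.re},
        DifferentiableAt ℂ (fun U => (perronIter F U m).2 n) U := fun n U hU =>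
      (ih n).2.differentiableAt ((isOpen_re_gt R).mem_nhds hU)
    constructor
    · simp only [perronIter, perronFst]
      refine DifferentiableOn.fun_sum fun j _ U hU => ?_
      have ha := perronIter_admissible hL (hR U hU) m
      have hz0 := ha.orbitFst_ne hL (hR U hU) j
      have hr := (hR U hU).two_div_le hL j
      exact (differentiableAt_shiftError hF (hz j U hU) (hw j U hU) hz0
        (hL.fst_ne _ _ hz0 ((ha.orbitFst_le hL (hR U hU) j).trans hr)
          ((ha.snd_le hL (hR U hU) j).trans hr))).differentiableWithinAt
    · simp only [perronIter, perronSnd]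
      refine DifferentiableOn.neg ?_
      have hs : Summable fun j : ℕ => 24 * M / (R + n + j) ^ 4 := by
        have hN : (1 : ℝ) ≤ R + n := by have : (0 : ℝ) ≤ n := n.cast_nonneg; linarith
        have hM := hL.one_le
        have := (summable_of_norm_le_inv_pow_four (c := 24 * M) hN
          (g := fun j : ℕ => ((24 * M / (R + n + j) ^ 4 : ℝ) : ℂ)) (fun j => by
            rw [Complex.norm_real, Real.norm_of_nonneg (by positivity)])).1
        exact_mod_cast this
      refine Complex.differentiableOn_tsum_of_summable_norm hs (fun j U hU => ?_)
        (isOpen_re_gt R) (fun j U hU => ?_)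
      · have ha := perronIter_admissible hL (hR U hU) m
        exact (differentiableAt_sndStep hF (hz _ U hU) (hw _ U hU)
          (ha.orbitFst_ne hL (hR U hU) _)).differentiableWithinAt
      · have ha := perronIter_admissible hL (hR U hU) m
        refine (ha.step_le hL (hR U hU) (n + j)).trans ?_
        have hU' : R < U.re := hU
        have hM := hL.one_le
        have : (0 : ℝ) ≤ n := n.cast_nonneg
        have : (0 : ℝ) ≤ j := j.cast_nonneg
        push_cast
        rw [← add_assoc]
        gcongr

/-- The stable curve as a function of `U = -1/z`: it is holomorphic on a half-plane, invariant,
attracted to the origin and of size `O(U⁻³)`. -/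
theorem exists_stable_function (hF : Differentiable ℂ F) (hL : LocalBounds F M r) :
    ∃ (R C : ℝ) (W : ℂ → ℂ), 1 ≤ R ∧ 0 ≤ C ∧ DifferentiableOn ℂ W {U | R < U.re} ∧
      (∀ U : ℂ, R < U.re → ‖W U‖ ≤ C / U.re ^ 3) ∧
      (∀ U : ℂ, R < U.re → ∃ e : ℂ, ‖e‖ ≤ 1 / 10 ∧
        F (-1 / U, W U) = (-1 / (U + 1 + e), W (U + 1 + e))) ∧
      ∀ U : ℂ, R < U.re → Tendsto (fun n : ℕ => F^[n] (-1 / U, W U)) atTop (𝓝 0) := by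
  classical
  have hr0 := hL.pos
  set R := max (400 * M) (2 / r) with hRdef
  have hR : ∀ U : ℂ, R < U.re → FarRight M r U := by
    intro U hU
    refine ⟨((le_max_left _ _).trans_lt hU).le, ?_⟩
    have := ((le_max_right _ _).trans_lt hU).le
    rw [div_le_iff₀ hr0] at this
    linarith
  have hR1 : 1 ≤ R := by
    have := hL.one_le
    have := le_max_left (400 * M) (2 / r)
    linarith
  have hM := hL.one_le
  have hex : ∀ U : ℂ, ∃ p : (ℕ → ℂ) × (ℕ → ℂ), R < U.re → IsPerronFixed F U p.1 p.2 ∧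
      ∀ m : ℕ, ‖(perronIter F U m).2 0 - p.2 0‖ ≤ 8 / 2 ^ m := by
    intro U
    by_cases hU : R < U.re
    · obtain ⟨u, w, h⟩ := exists_isPerronFixed hL (hR U hU)
      exact ⟨(u, w), fun _ => h⟩
    · exact ⟨0, fun h => absurd h hU⟩
  choose p hp using hex
  have horb : ∀ U : ℂ, R < U.re → (-1 / U, (p U).2 0) = (orbitFst U (p U).1 0, (p U).2 0) := by
    intro U hU
    have h1 := (hp U hU).1.adm.fst 0
    simp only [Nat.cast_zero, zero_div, norm_le_zero_iff] at h1
    simp [orbitFst, h1]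
  refine ⟨R, 48 * M, fun U => (p U).2 0, hR1, by linarith, ?_, ?_, ?_, ?_⟩
  · have hlim : TendstoUniformlyOn (fun m U => (perronIter F U m).2 0) (fun U => (p U).2 0) atTop
        {U : ℂ | R < U.re} := by
      rw [Metric.tendstoUniformlyOn_iff]
      intro ε hε
      have ht : Tendsto (fun m : ℕ => (8 : ℝ) / 2 ^ m) atTop (𝓝 0) := by
        have := (tendsto_pow_atTop_nhds_zero_of_lt_one (r := (1 / 2 : ℝ)) (by norm_num)
          (by norm_num)).const_mul 8
        simpa [div_eq_mul_inv] using this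
      filter_upwards [ht.eventually_lt_const hε] with m hm U hU
      rw [dist_comm, dist_eq_norm]
      exact ((hp U hU).2 m).trans_lt hm
    exact hlim.tendstoLocallyUniformlyOn.differentiableOn
      (Eventually.of_forall fun m => (differentiableOn_perronIter hF hL hR m 0).2) (isOpen_re_gt R)
  · intro U hU
    have := ((hp U hU).1.adm.perronSnd_le hL (hR U hU) 0).2
    rw [(hp U hU).1.snd] at this
    simpa using this
  · intro U hU
    have hfix := (hp U hU).1
    obtain ⟨h1, hU', hre, -⟩ := hfix.re_step hL (hR U hU)
    refine ⟨(p U).1 1, h1, ?_⟩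
    have hR' : R < (U + 1 + (p U).1 1).re := by linarith
    have hs := hfix.shift hL (hR U hU)
    have hq := (hp _ hR').1
    have := hs.adm.snd_unique hL hU' hq.adm hs.fst hs.snd hq.fst hq.snd
    simp only [horb U hU]
    rw [hfix.map hL (hR U hU) 0, ← this]
    simp [orbitFst]
  · intro U hU
    have hfix := (hp U hU).1
    have hit : ∀ n : ℕ, F^[n] (-1 / U, (p U).2 0) = (orbitFst U (p U).1 n, (p U).2 n) := by
      intro n
      induction n with
      | zero => simp only [Function.iterate_zero, id]; exact horb U hU
      | succ n ih => rw [Function.iterate_succ_apply', ih, hfix.map hL (hR U hU) n]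
    have hb : Tendsto (fun n : ℕ => 2 / (U.re + n)) atTop (𝓝 0) :=
      tendsto_const_nhds.div_atTop
        (tendsto_atTop_add_const_left _ _ tendsto_natCast_atTop_atTop)
    simp only [hit]
    rw [show (0 : ℂ × ℂ) = ((0 : ℂ), (0 : ℂ)) from rfl]
    exact (squeeze_zero_norm (fun n => hfix.adm.orbitFst_le hL (hR U hU) n) hb).prodMk_nhds
      (squeeze_zero_norm (fun n => hfix.adm.snd_le hL (hR U hU) n) hb)

end

/-! ### Geometry of the sector -/

/-- The slope `tan (π/8)` of the sides of the sector. -/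
noncomputable def sectorSlope : ℝ := Real.tan (Real.pi / 8)

theorem sectorSlope_bounds : 2 / 5 < sectorSlope ∧ sectorSlope < 1 / 2 := by
  have hpos : 0 < sectorSlope := by
    have := Real.lt_tan (x := Real.pi / 8) (by positivity) (by linarith [Real.pi_pos])
    exact lt_trans (by positivity) this
  have h1 : sectorSlope < 1 := by
    have := Real.tan_lt_tan_of_nonneg_of_lt_pi_div_two (x := Real.pi / 8) (y := Real.pi / 4)
      (by positivity) (by linarith [Real.pi_pos]) (by linarith [Real.pi_pos])
    rwa [Real.tan_pi_div_four] at this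
  have h2 : 2 * sectorSlope / (1 - sectorSlope ^ 2) = 1 := by
    have := Real.tan_two_mul (x := Real.pi / 8)
    rw [show 2 * (Real.pi / 8) = Real.pi / 4 by ring, Real.tan_pi_div_four] at this
    exact this.symm
  have h3 : 0 < 1 - sectorSlope ^ 2 := by nlinarith
  rw [div_eq_iff h3.ne'] at h2
  constructor <;> nlinarith

theorem mem_sector_iff {ε : ℝ} {z : ℂ} :
    z ∈ sector ε ↔ ‖z‖ < ε ∧ |z.im| < sectorSlope * -z.re := by
  have hτ := sectorSlope_bounds
  have hπ := Real.pi_pos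
  have key : ∀ x : ℂ, x ≠ 0 → (|x.arg| < Real.pi / 8 ↔ |x.im| < sectorSlope * x.re) := by
    intro x hx
    constructor
    · intro h
      have hre : 0 < x.re := by
        rcases Complex.abs_arg_lt_pi_div_two_iff.1 (h.trans (by linarith)) with h | h
        · exact h
        · exact absurd h hx
      rw [abs_lt] at h
      have h1 := Real.tan_lt_tan_of_lt_of_lt_pi_div_two (x := x.arg) (y := Real.pi / 8)
        (by linarith) (by linarith) h.2
      have h2 := Real.tan_lt_tan_of_lt_of_lt_pi_div_two (x := -(Real.pi / 8)) (y := x.arg)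
        (by linarith) (by linarith) h.1
      rw [Real.tan_neg] at h2
      rw [Complex.tan_arg] at h1 h2
      rw [div_lt_iff₀ hre] at h1
      rw [lt_div_iff₀ hre] at h2
      rw [abs_lt]
      exact ⟨by linarith [show -sectorSlope * x.re < x.im from h2], h1⟩
    · intro h
      have hre : 0 < x.re := by
        by_contra hneg
        have := abs_nonneg x.im
        nlinarith
      have hlt : |x.arg| < Real.pi / 2 := Complex.abs_arg_lt_pi_div_two_iff.2 (Or.inl hre)
      by_contra hge
      push Not at hge
      rw [abs_lt] at hlt h
      rcases le_abs.1 hge with h1 | h1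
      · have h2 : sectorSlope ≤ Real.tan x.arg := by
          rcases h1.eq_or_lt with h1 | h1
          · rw [← h1]; rfl
          · exact (Real.tan_lt_tan_of_lt_of_lt_pi_div_two (by linarith) hlt.2 h1).le
        rw [Complex.tan_arg, le_div_iff₀ hre] at h2
        linarith
      · have h2 : Real.tan x.arg ≤ -sectorSlope := by
          unfold sectorSlope
          rw [← Real.tan_neg]
          have h3 : x.arg ≤ -(Real.pi / 8) := by linarith
          rcases h3.eq_or_lt with h3 | h3
          · rw [h3]
          · exact (Real.tan_lt_tan_of_lt_of_lt_pi_div_two hlt.1 (by linarith) h3).le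
        rw [Complex.tan_arg, div_le_iff₀ hre] at h2
        linarith
  constructor
  · rintro ⟨h0, h1, h2⟩
    have := (key (-z) (neg_ne_zero.2 (norm_pos_iff.1 h0))).1 h2
    exact ⟨h1, by simpa using this⟩
  · rintro ⟨h1, h2⟩
    have h0 : z ≠ 0 := by rintro rfl; simp at h2
    exact ⟨norm_pos_iff.2 h0, h1, (key (-z) (neg_ne_zero.2 h0)).2 (by simpa using h2)⟩

theorem isOpen_sector (ε : ℝ) : IsOpen (sector ε) := by
  have : sector ε = {z | ‖z‖ < ε} ∩ {z | |z.im| < sectorSlope * -z.re} := by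
    ext z; exact mem_sector_iff
  rw [this]
  exact (isOpen_lt continuous_norm continuous_const).inter
    (isOpen_lt Complex.continuous_im.abs (continuous_const.mul Complex.continuous_re.neg))

theorem convex_sector (ε : ℝ) : Convex ℝ (sector ε) := by
  intro x hx y hy a b ha hb hab
  rw [mem_sector_iff] at *
  have h1 := convex_ball (0 : ℂ) ε (x := x) (by simpa using hx.1) (y := y) (by simpa using hy.1)
    ha hb hab
  refine ⟨by simpa using h1, ?_⟩
  have e1 : (a • x + b • y).im = a * x.im + b * y.im := by simp
  have e2 : (a • x + b • y).re = a * x.re + b * y.re := by simp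
  rw [e1, e2]
  have h2 : |a * x.im + b * y.im| ≤ a * |x.im| + b * |y.im| := by
    refine (abs_add_le _ _).trans ?_
    rw [abs_mul, abs_mul, abs_of_nonneg ha, abs_of_nonneg hb]
  refine h2.trans_lt ?_
  rcases ha.eq_or_lt with rfl | ha
  · have : b = 1 := by linarith
    subst this
    linarith [hy.2]
  · have := mul_lt_mul_of_pos_left hx.2 ha
    have := mul_le_mul_of_nonneg_left hy.2.le hb
    linarith

theorem ne_zero_of_mem_sector {ε : ℝ} {z : ℂ} (hz : z ∈ sector ε) : z ≠ 0 :=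
  norm_pos_iff.1 hz.1

theorem sector_mono {ε ε' : ℝ} (h : ε ≤ ε') : sector ε ⊆ sector ε' :=
  fun _ hz => ⟨hz.1, hz.2.1.trans_le h, hz.2.2⟩

theorem neg_one_div_re (z : ℂ) : (-1 / z).re = -z.re / ‖z‖ ^ 2 := by
  rw [neg_div, one_div, Complex.neg_re, Complex.inv_re, Complex.normSq_eq_norm_sq, neg_div]

theorem neg_one_div_im (z : ℂ) : (-1 / z).im = z.im / ‖z‖ ^ 2 := by
  rw [neg_div, one_div, Complex.neg_im, Complex.inv_im, Complex.normSq_eq_norm_sq, neg_div, neg_neg]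

theorem neg_one_div_neg_one_div (z : ℂ) : -1 / (-1 / z) = z := by
  rw [neg_div, one_div, neg_div, one_div, inv_neg, inv_inv, neg_neg]

theorem neg_one_div_mem_sector_iff {ε : ℝ} (hε : 0 < ε) {U : ℂ} :
    -1 / U ∈ sector ε ↔ 1 / ε < ‖U‖ ∧ |U.im| < sectorSlope * U.re := by
  rw [mem_sector_iff]
  rcases eq_or_ne U 0 with rfl | hU
  · simp
  have hn : 0 < ‖U‖ := norm_pos_iff.2 hU
  have e1 : ‖-1 / U‖ < ε ↔ 1 / ε < ‖U‖ := by
    rw [norm_div, norm_neg, norm_one]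
    exact one_div_lt hn hε
  rw [e1, neg_one_div_re, neg_one_div_im, abs_div, abs_of_nonneg (by positivity : 0 ≤ ‖U‖ ^ 2),
    neg_div, neg_neg, mul_div_assoc', div_lt_div_iff_of_pos_right (by positivity)]

theorem norm_le_of_slope {U : ℂ} (hU : |U.im| ≤ sectorSlope * U.re) : ‖U‖ ≤ 9 / 8 * U.re := by
  have hτ := sectorSlope_bounds
  have h0 := abs_nonneg U.im
  have hre : 0 ≤ U.re := by
    by_contra h
    nlinarith
  have h1 : |U.im| ≤ 1 / 2 * U.re := by nlinarith
  refine abs_le_of_sq_le_sq' ?_ (by positivity) |>.2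
  rw [Complex.sq_norm, Complex.normSq_apply]
  have : U.im * U.im ≤ 1 / 2 * U.re * (1 / 2 * U.re) := by
    rw [← abs_mul_abs_self U.im]; gcongr
  nlinarith

theorem abs_im_lt_step {U e : ℂ} (hU : |U.im| < sectorSlope * U.re) (he : ‖e‖ ≤ 1 / 10) :
    |(U + 1 + e).im| < sectorSlope * (U + 1 + e).re ∧ U.re + 9 / 10 ≤ (U + 1 + e).re := by
  have hτ := sectorSlope_bounds
  have h1 := abs_le.1 ((Complex.abs_re_le_norm e).trans he)
  have h2 := (Complex.abs_im_le_norm e).trans he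
  have e1 : (U + 1 + e).im = U.im + e.im := by simp
  have e2 : (U + 1 + e).re = U.re + 1 + e.re := by simp
  rw [e1, e2]
  refine ⟨?_, by linarith⟩
  have := abs_add_le U.im e.im
  nlinarith

theorem norm_step {U e : ℂ} (hU : |U.im| < sectorSlope * U.re) (he : ‖e‖ ≤ 1 / 10) :
    ‖U‖ + 7 / 10 ≤ ‖U + 1 + e‖ := by
  have h1 := norm_le_of_slope hU.le
  have h2 : ‖U‖ + 8 / 10 ≤ ‖U + 1‖ := by
    refine abs_le_of_sq_le_sq' ?_ (norm_nonneg _) |>.2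
    have e : ‖U + 1‖ ^ 2 = ‖U‖ ^ 2 + 2 * U.re + 1 := by
      rw [Complex.sq_norm, Complex.sq_norm, Complex.normSq_apply, Complex.normSq_apply]
      simp; ring
    rw [e]
    nlinarith [norm_nonneg U]
  have h3 := norm_sub_norm_le (U + 1) (-e)
  rw [norm_neg, sub_neg_eq_add] at h3
  linarith

/-! ### Existence of a parabolic curve -/

theorem exists_isParabolicCurve {F : ℂ × ℂ ≃ ℂ × ℂ} (hF : IsDegenerateAutomorphism F) :
    ∃ ε₁ : ℝ, 0 < ε₁ ∧ ∃ γ : ℂ → ℂ, IsParabolicCurve F γ ε₁ := by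
  obtain ⟨M, r, hL⟩ := exists_localBounds hF
  obtain ⟨R, C, W, hR1, hC0, hW, hWb, hWF, hWlim⟩ := exists_stable_function hF.holo hL
  have hτ := sectorSlope_bounds
  set γ : ℂ → ℂ := fun z => if z = 0 then 0 else W (-1 / z) with hγdef
  have hγ : ∀ z, z ≠ 0 → γ z = W (-1 / z) := fun z hz => if_neg hz
  set ε₁ : ℝ := 1 / (4 * R) with hε₁
  have hε₁0 : 0 < ε₁ := by positivity
  -- the closed sector without its vertex lies well inside the half-plane, seen from infinity
  have hcl : ∀ z ∈ closure (sector ε₁), z ≠ 0 →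
      2 * R < (-1 / z).re ∧ ‖-1 / z‖ ≤ 9 / 8 * (-1 / z).re := by
    intro z hz hz0
    have hsub : closure (sector ε₁) ⊆ {z | ‖z‖ ≤ ε₁} ∩ {z | |z.im| ≤ sectorSlope * -z.re} := by
      refine closure_minimal (fun x hx => ?_) ((isClosed_le continuous_norm continuous_const).inter
        (isClosed_le Complex.continuous_im.abs (continuous_const.mul Complex.continuous_re.neg)))
      have := mem_sector_iff.1 hx
      exact ⟨this.1.le, this.2.le⟩
    obtain ⟨h1, h2⟩ := hsub hz
    simp only [Set.mem_ofPred_eq] at h1 h2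
    have hn : 0 < ‖z‖ := norm_pos_iff.2 hz0
    have h3 : ‖-1 / z‖ ≤ 9 / 8 * (-1 / z).re := by
      apply norm_le_of_slope
      rw [neg_one_div_re, neg_one_div_im, abs_div, abs_of_nonneg (by positivity : 0 ≤ ‖z‖ ^ 2),
        mul_div_assoc']
      gcongr
    refine ⟨?_, h3⟩
    have h4 : 4 * R ≤ ‖-1 / z‖ := by
      rw [norm_div, norm_neg, norm_one, le_div_iff₀ hn]
      rw [hε₁, le_div_iff₀ (by positivity)] at h1
      linarith
    linarith
  have hsec : ∀ z ∈ sector ε₁, z ≠ 0 ∧ 2 * R < (-1 / z).re ∧ ‖-1 / z‖ ≤ 9 / 8 * (-1 / z).re ∧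
      γ z = W (-1 / z) := by
    intro z hz
    have h0 := ne_zero_of_mem_sector hz
    exact ⟨h0, (hcl z (subset_closure hz) h0).1, (hcl z (subset_closure hz) h0).2, hγ z h0⟩
  have hdiff : ∀ z, z ≠ 0 → R < (-1 / z).re → DifferentiableAt ℂ γ z := by
    intro z hz hre
    have h1 : DifferentiableAt ℂ (fun z => W (-1 / z)) z :=
      (hW.differentiableAt ((isOpen_re_gt R).mem_nhds hre)).comp z
        ((differentiableAt_const _).div differentiableAt_id hz)
    refine h1.congr_of_eventuallyEq ?_
    filter_upwards [isOpen_ne.mem_nhds hz] with x hx using hγ x hx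
  have hbound : ∀ z, z ≠ 0 → R < (-1 / z).re → ‖-1 / z‖ ≤ 3 * (-1 / z).re →
      ‖γ z‖ ≤ 27 * C * ‖z‖ ^ 3 := by
    intro z hz hre hn
    have hn0 : 0 < ‖z‖ := norm_pos_iff.2 hz
    rw [hγ z hz]
    refine (hWb _ hre).trans ?_
    have h1 : 1 ≤ 3 * (-1 / z).re * ‖z‖ := by
      rw [norm_div, norm_neg, norm_one, div_le_iff₀ hn0] at hn
      exact hn
    have h2 : 0 < (-1 / z).re := by linarith
    rw [div_le_iff₀ (by positivity)]
    calc C = C * 1 ^ 3 := by ring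
      _ ≤ C * (3 * (-1 / z).re * ‖z‖) ^ 3 := by gcongr
      _ = _ := by ring
  refine ⟨ε₁, hε₁0, γ, ?_, ?_, if_pos rfl, ?_, ?_, ?_, ?_⟩
  · intro z hz
    obtain ⟨h0, h1, -⟩ := hsec z hz
    exact (hdiff z h0 (by linarith)).differentiableWithinAt
  · intro z hz
    rcases eq_or_ne z 0 with rfl | h0
    · unfold ContinuousWithinAt
      rw [show γ 0 = 0 from if_pos rfl]
      have ht : Tendsto (fun x : ℂ => 27 * C * ‖x‖ ^ 3) (𝓝[closure (sector ε₁)] 0) (𝓝 0) := by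
        have : Continuous fun x : ℂ => 27 * C * ‖x‖ ^ 3 := by fun_prop
        have := this.tendsto 0
        simp only [norm_zero, ne_eq, OfNat.ofNat_ne_zero, not_false_eq_true, zero_pow,
          mul_zero] at this
        exact this.mono_left nhdsWithin_le_nhds
      refine squeeze_zero_norm' ?_ ht
      filter_upwards [self_mem_nhdsWithin] with x hx
      rcases eq_or_ne x 0 with rfl | hx0
      · simp [γ]
      · obtain ⟨h1, h2⟩ := hcl x hx hx0
        exact hbound x hx0 (by linarith) (by linarith)
    · have h1 := (hcl z hz h0).1
      exact (hdiff z h0 (by linarith)).continuousAt.continuousWithinAt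
  · rintro _ ⟨z, hz, rfl⟩
    obtain ⟨h0, h1, h2, h3⟩ := hsec z hz
    obtain ⟨e, he, hmap⟩ := hWF (-1 / z) (by linarith)
    rw [neg_one_div_neg_one_div] at hmap
    have hz' : -1 / (-1 / z) ∈ sector ε₁ := by rwa [neg_one_div_neg_one_div]
    obtain ⟨h4, h5⟩ := (neg_one_div_mem_sector_iff hε₁0).1 hz'
    have h6 := abs_im_lt_step h5 he
    have h7 := norm_step h5 he
    have hne : -1 / z + 1 + e ≠ 0 := fun h => by
      rw [h] at h7
      have := norm_nonneg (-1 / z)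
      rw [norm_zero] at h7
      linarith
    refine ⟨-1 / (-1 / z + 1 + e), (neg_one_div_mem_sector_iff hε₁0).2 ⟨by linarith, h6.1⟩, ?_⟩
    change (_, _) = F (z, γ z)
    rw [h3, hmap, hγ _ (div_ne_zero (by simp) hne), neg_one_div_neg_one_div]
  · rintro _ ⟨z, hz, rfl⟩
    obtain ⟨h0, h1, h2, h3⟩ := hsec z hz
    have := hWlim (-1 / z) (by linarith)
    rw [neg_one_div_neg_one_div] at this
    simpa only [h3] using this
  · refine ⟨27 * C, fun z hz => ?_⟩
    obtain ⟨h0, h1, h2, h3⟩ := hsec z hz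
    exact hbound z h0 (by linarith) (by linarith)
  · -- Cauchy's estimate on the disc of radius `|z|/4` about `z`
    refine ⟨8 * 27 * C, fun z hz => ?_⟩
    obtain ⟨h0, h1, h2, h3⟩ := hsec z hz
    have hn : 0 < ‖z‖ := norm_pos_iff.2 h0
    have hdisc : ∀ x ∈ Metric.closedBall z (‖z‖ / 4), x ≠ 0 ∧ R < (-1 / x).re ∧
        ‖-1 / x‖ ≤ 3 * (-1 / x).re ∧ ‖x‖ ≤ 5 / 4 * ‖z‖ := by
      intro x hx
      rw [mem_closedBall_iff_norm] at hx
      have hx1 : 3 / 4 * ‖z‖ ≤ ‖x‖ := by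
        have := norm_sub_norm_le z x
        rw [norm_sub_rev] at this
        linarith
      have hx2 : ‖x‖ ≤ 5 / 4 * ‖z‖ := by
        have := norm_sub_norm_le x z
        linarith
      have hxn : 0 < ‖x‖ := by linarith
      have hx0 : x ≠ 0 := norm_pos_iff.1 hxn
      have hδ : ‖-1 / x - -1 / z‖ ≤ 1 / 3 * ‖-1 / z‖ := by
        have e : -1 / x - -1 / z = (x - z) / (x * z) := by field_simp; ring
        rw [e, norm_div, norm_mul, norm_div, norm_neg, norm_one, mul_one_div,
          div_le_div_iff₀ (by positivity) hn]
        have : 1 / 3 * (‖x‖ * ‖z‖) ≥ 1 / 3 * (3 / 4 * ‖z‖ * ‖z‖) := by gcongr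
        have : ‖x - z‖ * ‖z‖ ≤ ‖z‖ / 4 * ‖z‖ := by gcongr
        linarith
      have h4 := (Complex.abs_re_le_norm (-1 / x - -1 / z)).trans hδ
      rw [Complex.sub_re] at h4
      have h5 := (abs_le.1 h4).1
      have h6 := norm_sub_norm_le (-1 / x) (-1 / z)
      exact ⟨hx0, by linarith, by linarith, hx2⟩
    have hcd : DiffContOnCl ℂ γ (Metric.ball z (‖z‖ / 4)) := by
      refine DifferentiableOn.diffContOnCl_ball (U := Metric.closedBall z (‖z‖ / 4))
        (fun x hx => ?_) subset_rfl
      obtain ⟨hx0, hx1, -⟩ := hdisc x hx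
      exact (hdiff x hx0 hx1).differentiableWithinAt
    have := Complex.norm_deriv_le_of_forall_mem_sphere_norm_le (f := γ) (c := z) (R := ‖z‖ / 4)
      (C := 2 * (27 * C * ‖z‖ ^ 3)) (by positivity) hcd (fun x hx => by
        obtain ⟨hx0, hx1, hx2, hx3⟩ := hdisc x (Metric.sphere_subset_closedBall hx)
        refine (hbound x hx0 hx1 hx2).trans ?_
        calc 27 * C * ‖x‖ ^ 3 ≤ 27 * C * (5 / 4 * ‖z‖) ^ 3 := by gcongr
          _ = 125 / 64 * (27 * C * ‖z‖ ^ 3) := by ring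
          _ ≤ _ := by gcongr; norm_num)
    refine this.trans_eq ?_
    field_simp
    ring

/-! ### Fatou coordinates of perturbed translations -/

/-- The convex region `Re U > R`, `|Im U| < tan (π/8) Re U`. -/
def coneRegion (R : ℝ) : Set ℂ := {U | R < U.re ∧ |U.im| < sectorSlope * U.re}

theorem isOpen_coneRegion (R : ℝ) : IsOpen (coneRegion R) :=
  (isOpen_re_gt R).inter
    (isOpen_lt Complex.continuous_im.abs (continuous_const.mul Complex.continuous_re))

/-- A perturbation `U ↦ U + 1 + κ U` of the translation on `coneRegion R`, with a perturbation `κ`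
that decays like `1/U` together with its difference quotients. -/
structure IsPerturbedTranslation (κ : ℂ → ℂ) (B R : ℝ) : Prop where
  one_le : 1 ≤ B
  large : 12 * B ≤ R
  diff : DifferentiableOn ℂ κ (coneRegion R)
  small : ∀ U ∈ coneRegion R, ‖κ U‖ ≤ 1 / 10
  decay : ∀ U ∈ coneRegion R, ‖κ U‖ ≤ B / U.re
  lip : ∀ U ∈ coneRegion R, ∀ U' ∈ coneRegion R,
    ‖κ U - κ U'‖ ≤ B * ‖U - U'‖ / (U.re * U'.re)

/-- The map `U ↦ U + 1 + κ U`. -/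
def shiftMap (κ : ℂ → ℂ) (U : ℂ) : ℂ := U + 1 + κ U

namespace IsPerturbedTranslation
variable {κ : ℂ → ℂ} {B R : ℝ}

theorem mapsTo (h : IsPerturbedTranslation κ B R) {U : ℂ} (hU : U ∈ coneRegion R) :
    shiftMap κ U ∈ coneRegion R := by
  have := abs_im_lt_step hU.2 (h.small U hU)
  refine ⟨?_, this.1⟩
  have h1 := hU.1
  unfold shiftMap
  linarith

theorem iterate_mem (h : IsPerturbedTranslation κ B R) {U : ℂ} (hU : U ∈ coneRegion R) (n : ℕ) :
    (shiftMap κ)^[n] U ∈ coneRegion R ∧ U.re + 9 / 10 * n ≤ ((shiftMap κ)^[n] U).re ∧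
      |((shiftMap κ)^[n] U).im| ≤ |U.im| + n / 10 := by
  induction n with
  | zero => simpa using hU
  | succ n ih =>
    rw [Function.iterate_succ_apply']
    obtain ⟨h1, h2, h3⟩ := ih
    have hs := h.small _ h1
    refine ⟨h.mapsTo h1, ?_, ?_⟩
    · have := (abs_im_lt_step h1.2 hs).2
      unfold shiftMap at *
      push_cast
      linarith
    · have h4 := (Complex.abs_im_le_norm _).trans hs
      set V := (shiftMap κ)^[n] U
      have e : (shiftMap κ V).im = V.im + (κ V).im := by simp [shiftMap]
      have := abs_add_le V.im (κ V).im
      rw [e]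
      push_cast
      linarith

theorem iterate_eq_add_sum (κ : ℂ → ℂ) (U : ℂ) (n : ℕ) :
    (shiftMap κ)^[n] U = U + n + ∑ j ∈ Finset.range n, κ ((shiftMap κ)^[j] U) := by
  induction n with
  | zero => simp
  | succ n ih =>
    rw [Function.iterate_succ_apply', Finset.sum_range_succ, shiftMap]
    conv_lhs => enter [1, 1]; rw [ih]
    push_cast
    ring

theorem differentiableOn_iterate (h : IsPerturbedTranslation κ B R) (n : ℕ) :
    DifferentiableOn ℂ ((shiftMap κ)^[n]) (coneRegion R) := by
  induction n with
  | zero => exact differentiableOn_id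
  | succ n ih =>
    rw [Function.iterate_succ']
    have h1 : DifferentiableOn ℂ (shiftMap κ) (coneRegion R) :=
      (differentiableOn_id.add_const 1).add h.diff
    exact h1.comp ih fun U hU => (h.iterate_mem hU n).1

theorem diff_term_le (h : IsPerturbedTranslation κ B R) {U U' : ℂ} (hU : U ∈ coneRegion R)
    (hU' : U' ∈ coneRegion R) {n : ℕ} {d : ℝ}
    (hd : ‖(shiftMap κ)^[n] U - (shiftMap κ)^[n] U'‖ ≤ d) :
    ‖κ ((shiftMap κ)^[n] U) - κ ((shiftMap κ)^[n] U')‖ ≤ 4 * B * d * (1 / (2 * R + n) ^ 2) := by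
  obtain ⟨h1, h2, -⟩ := h.iterate_mem hU n
  obtain ⟨h1', h2', -⟩ := h.iterate_mem hU' n
  refine (h.lip _ h1 _ h1').trans ?_
  have hB := h.one_le
  have hR := h.large
  have hn : (0 : ℝ) ≤ n := n.cast_nonneg
  have a1 : (2 * R + n) / 2 ≤ ((shiftMap κ)^[n] U).re := by have := hU.1; linarith
  have a2 : (2 * R + n) / 2 ≤ ((shiftMap κ)^[n] U').re := by have := hU'.1; linarith
  have a0 : 0 < (2 * R + n) / 2 := by linarith
  have a3 := a0.le.trans a1
  have hd0 := (norm_nonneg _).trans hd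
  calc B * ‖(shiftMap κ)^[n] U - (shiftMap κ)^[n] U'‖ /
        (((shiftMap κ)^[n] U).re * ((shiftMap κ)^[n] U').re)
      ≤ B * d / ((2 * R + n) / 2 * ((2 * R + n) / 2)) := by gcongr
    _ = _ := by field_simp; ring

/-- The distance of two orbits stays comparable to the initial one. -/
theorem iterate_sub (h : IsPerturbedTranslation κ B R) {U U' : ℂ} (hU : U ∈ coneRegion R)
    (hU' : U' ∈ coneRegion R) (n : ℕ) :
    ‖(shiftMap κ)^[n] U - (shiftMap κ)^[n] U' - (U - U')‖ ≤ 1 / 2 * ‖U - U'‖ := by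
  have hB := h.one_le
  have hR := h.large
  induction n using Nat.strong_induction_on with
  | _ n ih =>
    have e : (shiftMap κ)^[n] U - (shiftMap κ)^[n] U' - (U - U') =
        ∑ j ∈ Finset.range n, (κ ((shiftMap κ)^[j] U) - κ ((shiftMap κ)^[j] U')) := by
      rw [iterate_eq_add_sum κ U n, iterate_eq_add_sum κ U' n, Finset.sum_sub_distrib]
      ring
    rw [e]
    have hterm : ∀ j ∈ Finset.range n, ‖κ ((shiftMap κ)^[j] U) - κ ((shiftMap κ)^[j] U')‖ ≤
        4 * B * (3 / 2 * ‖U - U'‖) * (1 / (2 * R + j) ^ 2) := by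
      intro j hj
      refine h.diff_term_le hU hU' ?_
      have h1 := ih j (Finset.mem_range.1 hj)
      have h2 := norm_sub_norm_le ((shiftMap κ)^[j] U - (shiftMap κ)^[j] U') (U - U')
      linarith
    refine (norm_sum_le_of_le _ hterm).trans ?_
    rw [← Finset.mul_sum]
    have hs := sum_inv_sq_le (N := 2 * R) (by linarith) n
    have hd := norm_nonneg (U - U')
    calc 4 * B * (3 / 2 * ‖U - U'‖) * ∑ j ∈ Finset.range n, 1 / (2 * R + (j : ℝ)) ^ 2
        ≤ 4 * B * (3 / 2 * ‖U - U'‖) * (2 / (2 * R)) := by gcongr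
      _ = 12 * B / R * (1 / 2 * ‖U - U'‖) := by
        field_simp
        ring
      _ ≤ 1 * (1 / 2 * ‖U - U'‖) := by
        gcongr
        rw [div_le_one (by linarith)]
        exact hR
      _ = _ := one_mul _

/-- The Fatou coordinate: a holomorphic conjugation to the unit translation which is close to the
identity in the Lipschitz sense. It is the limit of `g^n U - g^n U₀` for a base point `U₀`. -/
theorem exists_fatou (h : IsPerturbedTranslation κ B R) :
    ∃ φ : ℂ → ℂ, DifferentiableOn ℂ φ (coneRegion R) ∧
      (∀ U ∈ coneRegion R, φ (shiftMap κ U) = φ U + 1) ∧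
      ∀ U ∈ coneRegion R, ∀ U' ∈ coneRegion R,
        ‖φ U - φ U' - (U - U')‖ ≤ 1 / 2 * ‖U - U'‖ := by
  have hB := h.one_le
  have hR := h.large
  have hτ := sectorSlope_bounds
  obtain ⟨U₀, hU₀⟩ : ∃ U₀, U₀ ∈ coneRegion R :=
    ⟨((R + 1 : ℝ) : ℂ), by
      rw [coneRegion, Set.mem_ofPred_eq, Complex.ofReal_re, Complex.ofReal_im, abs_zero]
      exact ⟨by linarith, by nlinarith⟩⟩
  set T : ℕ → ℂ → ℂ := fun j U => κ ((shiftMap κ)^[j] U) - κ ((shiftMap κ)^[j] U₀) with hT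
  have hterm : ∀ U ∈ coneRegion R, ∀ j : ℕ,
      ‖T j U‖ ≤ 4 * B * (3 / 2 * ‖U - U₀‖) * (1 / (2 * R + j) ^ 2) := by
    intro U hU j
    refine h.diff_term_le hU hU₀ ?_
    have h1 := h.iterate_sub hU hU₀ j
    have h2 := norm_sub_norm_le ((shiftMap κ)^[j] U - (shiftMap κ)^[j] U₀) (U - U₀)
    linarith
  have hsq : Summable fun j : ℕ => 1 / (2 * R + (j : ℝ)) ^ 2 :=
    summable_of_sum_range_le (fun j => by positivity) (sum_inv_sq_le (by linarith))
  have hsum : ∀ U ∈ coneRegion R, Summable fun j => T j U := fun U hU =>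
    Summable.of_norm_bounded (hsq.mul_left _) (hterm U hU)
  set φ : ℂ → ℂ := fun U => U - U₀ + ∑' j, T j U with hφ
  have hlim : ∀ U ∈ coneRegion R,
      Tendsto (fun n => (shiftMap κ)^[n] U - (shiftMap κ)^[n] U₀) atTop (𝓝 (φ U)) := by
    intro U hU
    have h1 := ((hsum U hU).hasSum.tendsto_sum_nat).const_add (U - U₀)
    refine h1.congr fun n => ?_
    rw [iterate_eq_add_sum κ U n, iterate_eq_add_sum κ U₀ n, hT, Finset.sum_sub_distrib]
    ring
  refine ⟨φ, ?_, ?_, ?_⟩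
  · intro U hU
    -- near `U` the series is dominated by a fixed summable series
    have hopen : IsOpen (coneRegion R ∩ Metric.ball U 1) :=
      (isOpen_coneRegion R).inter Metric.isOpen_ball
    have h1 : DifferentiableOn ℂ (fun V => ∑' j, T j V) (coneRegion R ∩ Metric.ball U 1) := by
      refine Complex.differentiableOn_tsum_of_summable_norm
        (hsq.mul_left (4 * B * (3 / 2 * (‖U - U₀‖ + 1)))) (fun j => ?_) hopen
        (fun j V hV => (hterm V hV.1 j).trans ?_)
      · exact ((h.diff.comp (h.differentiableOn_iterate j)
          fun V hV => (h.iterate_mem hV j).1).sub_const _).mono Set.inter_subset_left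
      · have h2 := mem_ball_iff_norm.1 hV.2
        have h3 : ‖V - U₀‖ ≤ ‖U - U₀‖ + 1 := by
          have := norm_sub_le_norm_sub_add_norm_sub V U U₀
          linarith
        gcongr
    have h2 := h1.differentiableAt (hopen.mem_nhds ⟨hU, Metric.mem_ball_self one_pos⟩)
    exact ((differentiableAt_id.sub_const U₀).add h2).differentiableWithinAt
  · intro U hU
    have h1 := (hlim U hU).comp (tendsto_add_atTop_nat 1)
    have h2 : Tendsto (fun n => κ ((shiftMap κ)^[n] U₀)) atTop (𝓝 0) := by
      have hb : Tendsto (fun n : ℕ => B / (R + 9 / 10 * (n : ℝ))) atTop (𝓝 0) :=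
        tendsto_const_nhds.div_atTop (tendsto_atTop_add_const_left _ _
          (tendsto_natCast_atTop_atTop.const_mul_atTop (by norm_num)))
      refine squeeze_zero_norm (fun n => ?_) hb
      obtain ⟨a1, a2, -⟩ := h.iterate_mem hU₀ n
      refine (h.decay _ a1).trans ?_
      have := hU₀.1
      have hn : (0 : ℝ) ≤ n := n.cast_nonneg
      exact div_le_div_of_nonneg_left (by linarith) (by linarith) (by linarith)
    have h3 := (h1.add_const 1).add h2
    rw [add_zero] at h3
    refine tendsto_nhds_unique (hlim _ (h.mapsTo hU)) (h3.congr fun n => ?_)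
    simp only [Function.comp]
    rw [Function.iterate_succ_apply, Function.iterate_succ_apply' _ _ U₀]
    conv_lhs => enter [1, 1, 2]; rw [shiftMap]
    ring
  · intro U hU U' hU'
    have h1 := ((hlim U hU).sub (hlim U' hU')).sub_const (U - U')
    refine le_of_tendsto h1.norm (Eventually.of_forall fun n => ?_)
    rw [sub_sub_sub_cancel_right]
    exact h.iterate_sub hU hU' n

end IsPerturbedTranslation

/-! ### Inverting the Fatou coordinate -/

theorem exists_eq_of_near_id {φ : ℂ → ℂ} {c y : ℂ} {ρ : ℝ}
    (hφ : ∀ U ∈ Metric.closedBall c ρ, ∀ U' ∈ Metric.closedBall c ρ,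
      ‖φ U - φ U' - (U - U')‖ ≤ 1 / 2 * ‖U - U'‖) (hρ : 0 ≤ ρ) (hy : ‖y - φ c‖ ≤ ρ / 2) :
    ∃ U ∈ Metric.closedBall c ρ, φ U = y := by
  set f : ℂ → ℂ := fun U => y - (φ U - U) with hf
  have hc : c ∈ Metric.closedBall c ρ := Metric.mem_closedBall_self hρ
  have hmaps : Set.MapsTo f (Metric.closedBall c ρ) (Metric.closedBall c ρ) := by
    intro U hU
    have h1 := hφ U hU c hc
    rw [mem_closedBall_iff_norm] at *
    have e : f U - c = (y - φ c) - (φ U - φ c - (U - c)) := by simp only [hf]; ring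
    rw [e]
    refine (norm_sub_le _ _).trans ?_
    linarith
  have hcontr : ContractingWith (1 / 2) (hmaps.restrict f _ _) := by
    refine ⟨by rw [← NNReal.coe_lt_coe]; norm_num, LipschitzWith.of_dist_le_mul ?_⟩
    rintro ⟨U, hU⟩ ⟨U', hU'⟩
    have h1 := hφ U hU U' hU'
    rw [Subtype.dist_eq, Subtype.dist_eq, dist_eq_norm, dist_eq_norm]
    have e : f U - f U' = -(φ U - φ U' - (U - U')) := by simp only [hf]; ring
    change ‖f U - f U'‖ ≤ _
    rw [e, norm_neg]
    simpa using h1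
  obtain ⟨U, hU, hfix, -⟩ := hcontr.exists_fixedPoint' Metric.isClosed_closedBall.isComplete hmaps
    hc (edist_ne_top _ _)
  refine ⟨U, hU, ?_⟩
  have h2 : y - (φ U - U) = U := hfix
  linear_combination -h2

theorem exists_inverse_of_near_id {φ : ℂ → ℂ} {K : Set ℂ} (hK : IsOpen K)
    (hd : DifferentiableOn ℂ φ K)
    (hφ : ∀ U ∈ K, ∀ U' ∈ K, ‖φ U - φ U' - (U - U')‖ ≤ 1 / 2 * ‖U - U'‖) :
    ∃ ψ : ℂ → ℂ, (∀ U ∈ K, ψ (φ U) = U) ∧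
      ∀ U ∈ K, φ '' K ∈ 𝓝 (φ U) ∧ DifferentiableAt ℂ ψ (φ U) := by
  have hlow : ∀ U ∈ K, ∀ U' ∈ K, ‖U - U'‖ ≤ 2 * ‖φ U - φ U'‖ := by
    intro U hU U' hU'
    have h1 := hφ U hU U' hU'
    have h2 := norm_sub_norm_le (U - U') (φ U - φ U')
    rw [norm_sub_rev (U - U')] at h2
    linarith
  have hinj : Set.InjOn φ K := by
    intro U hU U' hU' he
    have := hlow U hU U' hU'
    rw [he, sub_self, norm_zero, mul_zero] at this
    exact sub_eq_zero.1 (norm_le_zero_iff.1 this)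
  have hnhds : ∀ U ∈ K, φ '' K ∈ 𝓝 (φ U) := by
    intro U hU
    obtain ⟨ρ, hρ, hball⟩ := Metric.nhds_basis_closedBall.mem_iff.1 (hK.mem_nhds hU)
    refine mem_of_superset (Metric.closedBall_mem_nhds _ (half_pos hρ)) fun y hy => ?_
    obtain ⟨V, hV, rfl⟩ := exists_eq_of_near_id (fun V hV V' hV' => hφ V (hball hV) V' (hball hV'))
      hρ.le (mem_closedBall_iff_norm.1 hy)
    exact ⟨V, hball hV, rfl⟩
  refine ⟨Function.invFunOn φ K, fun U hU => hinj.leftInvOn_invFunOn hU, fun U hU =>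
    ⟨hnhds U hU, ?_⟩⟩
  have hψ : ∀ V ∈ K, Function.invFunOn φ K (φ V) = V := fun V hV => hinj.leftInvOn_invFunOn hV
  set ψ := Function.invFunOn φ K
  have hcont : ContinuousAt ψ (φ U) := by
    rw [ContinuousAt, tendsto_iff_norm_sub_tendsto_zero]
    have h1 : Tendsto (fun y => 2 * ‖y - φ U‖) (𝓝 (φ U)) (𝓝 0) := by
      have : Continuous fun y => 2 * ‖y - φ U‖ := by fun_prop
      simpa using this.tendsto (φ U)
    refine squeeze_zero' (Eventually.of_forall fun _ => norm_nonneg _) ?_ h1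
    filter_upwards [hnhds U hU] with y hy
    obtain ⟨V, hV, rfl⟩ := hy
    rw [hψ V hV, hψ U hU]
    exact hlow V hV U hU
  have hda := (hd.differentiableAt (hK.mem_nhds hU)).hasDerivAt
  have hne : deriv φ U ≠ 0 := by
    -- `φ - id` has Lipschitz constant `1/2`, hence `|φ' - 1| ≤ 1/2`
    have h1 : HasDerivAt (fun V => φ V - V) (deriv φ U - 1) U := hda.sub (hasDerivAt_id U)
    have h2 : ‖deriv φ U - 1‖ ≤ 1 / 2 := by
      refine h1.le_of_lip' (by norm_num) ?_
      filter_upwards [hK.mem_nhds hU] with V hV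
      have := hφ V hV U hU
      rwa [sub_sub_sub_comm] at this
    intro h0
    rw [h0, zero_sub, norm_neg, norm_one] at h2
    norm_num at h2
  refine (HasDerivAt.of_local_left_inverse (f := φ) (g := ψ) (f' := deriv φ U) (a := φ U) hcont
    ?_ hne ?_).differentiableAt
  · rwa [hψ U hU]
  · filter_upwards [hnhds U hU] with y hy
    obtain ⟨V, hV, rfl⟩ := hy
    rw [hψ V hV]

/-- The backward translates of the image of the Fatou coordinate exhaust the plane, since orbits
enter the cone ever more deeply. -/
theorem IsPerturbedTranslation.exists_fatou_eq {κ φ : ℂ → ℂ} {B R : ℝ}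
    (h : IsPerturbedTranslation κ B R)
    (hφ : ∀ U ∈ coneRegion R, φ (shiftMap κ U) = φ U + 1)
    (hφ' : ∀ U ∈ coneRegion R, ∀ U' ∈ coneRegion R, ‖φ U - φ U' - (U - U')‖ ≤ 1 / 2 * ‖U - U'‖)
    (t : ℂ) : ∃ n : ℕ, ∃ U ∈ coneRegion R, φ U = t + n := by
  have hB := h.one_le
  have hR := h.large
  have hτ := sectorSlope_bounds
  obtain ⟨U₀, hU₀⟩ : ∃ U₀, U₀ ∈ coneRegion R :=
    ⟨((R + 1 : ℝ) : ℂ), by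
      rw [coneRegion, Set.mem_ofPred_eq, Complex.ofReal_re, Complex.ofReal_im, abs_zero]
      exact ⟨by linarith, by nlinarith⟩⟩
  have hφn : ∀ n : ℕ, φ ((shiftMap κ)^[n] U₀) = φ U₀ + n := by
    intro n
    induction n with
    | zero => simp
    | succ n ih =>
      rw [Function.iterate_succ_apply', hφ _ (h.iterate_mem hU₀ n).1, ih]
      push_cast
      ring
  set ρ := 2 * ‖t - φ U₀‖ with hρ
  have hρ0 : 0 ≤ ρ := by positivity
  obtain ⟨n, hn⟩ := exists_nat_gt (10 * (2 * ρ + |U₀.im|))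
  obtain ⟨a1, a2, a3⟩ := h.iterate_mem hU₀ n
  have him := abs_nonneg U₀.im
  have hsub : Metric.closedBall ((shiftMap κ)^[n] U₀) ρ ⊆ coneRegion R := by
    intro V hV
    rw [mem_closedBall_iff_norm] at hV
    have b1 := (Complex.abs_re_le_norm _).trans hV
    have b2 := (Complex.abs_im_le_norm _).trans hV
    rw [Complex.sub_re] at b1
    rw [Complex.sub_im] at b2
    have b3 := (abs_le.1 b1).1
    have b4 := abs_sub_abs_le_abs_sub V.im ((shiftMap κ)^[n] U₀).im
    have hU₀re := hU₀.1
    refine ⟨by linarith, ?_⟩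
    have : 2 / 5 * V.re ≤ sectorSlope * V.re := by
      apply mul_le_mul_of_nonneg_right hτ.1.le; linarith
    linarith
  obtain ⟨U, hU, he⟩ := exists_eq_of_near_id (φ := φ) (y := t + n)
    (fun V hV V' hV' => hφ' V (hsub hV) V' (hsub hV')) hρ0 (by
      rw [hφn n, add_sub_add_right_eq_sub]; linarith)
  exact ⟨n, U, hsub hU, he⟩

/-! ### Bounds along a parabolic curve -/

/-- Quantitative control of a parabolic curve on the sector of radius `1/R`, with `R` large
compared with the constants involved. -/
structure CurveControl (F : ℂ × ℂ ≃ ℂ × ℂ) (γ : ℂ → ℂ) (M r C R : ℝ) : Prop where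
  one_le : 1 ≤ C
  large : 1000 * M * C ≤ R
  radius : 4 ≤ r * R
  diff : DifferentiableOn ℂ γ (sector (1 / R))
  size : ∀ z ∈ sector (1 / R), ‖γ z‖ ≤ C * ‖z‖ ^ 3
  lip : ∀ ρ ≤ 1 / R, ∀ z ∈ sector ρ, ∀ z' ∈ sector ρ, ‖γ z - γ z'‖ ≤ C * ρ ^ 2 * ‖z - z'‖
  inv : ∀ z ∈ sector (1 / R), (F (z, γ z)).2 = γ (F (z, γ z)).1

theorem exists_curveControl {F : ℂ × ℂ ≃ ℂ × ℂ} {γ : ℂ → ℂ} {M r ε₁ : ℝ} (hL : LocalBounds F M r)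
    (hε₁ : 0 < ε₁) (hγ : IsParabolicCurve F γ ε₁) :
    ∃ C R₀ : ℝ, 1 / ε₁ ≤ R₀ ∧ ∀ R ≥ R₀, CurveControl F γ M r C R := by
  obtain ⟨C₁, hC₁⟩ := hγ.size
  obtain ⟨C₂, hC₂⟩ := hγ.size_deriv
  obtain ⟨C, hC, hCC₁, hCC₂⟩ : ∃ C : ℝ, 1 ≤ C ∧ C₁ ≤ C ∧ C₂ ≤ C :=
    ⟨max 1 (max C₁ C₂), le_max_left _ _, (le_max_left _ _).trans (le_max_right _ _),
      (le_max_right _ _).trans (le_max_right _ _)⟩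
  have hr := hL.pos
  refine ⟨C, max (1 / ε₁) (max (1000 * M * C) (4 / r)), le_max_left _ _, fun R hR => ?_⟩
  have h1 : 1 / ε₁ ≤ R := (le_max_left _ _).trans hR
  have h2 : 1000 * M * C ≤ R := ((le_max_left _ _).trans (le_max_right _ _)).trans hR
  have h3 : 4 / r ≤ R := ((le_max_right _ _).trans (le_max_right _ _)).trans hR
  have hle : 1 / R ≤ ε₁ := by
    rw [one_div_le (lt_of_lt_of_le (by positivity) h1) hε₁]; exact h1
  have hsub := sector_mono hle
  refine ⟨hC, h2, ?_, hγ.holo.mono hsub, fun z hz => ?_, fun ρ hρ z hz z' hz' => ?_,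
    fun z hz => ?_⟩
  · rw [div_le_iff₀ hr] at h3; linarith
  · refine (hC₁ z (hsub hz)).trans ?_
    gcongr
  · refine (convex_sector ρ).norm_image_sub_le_of_norm_deriv_le (f := γ) (fun x hx => ?_)
      (fun x hx => ?_) hz' hz
    · exact hγ.holo.differentiableAt
        ((isOpen_sector _).mem_nhds (sector_mono (hρ.trans hle) hx))
    · refine (hC₂ x (sector_mono (hρ.trans hle) hx)).trans ?_
      have := hx.2.1.le
      gcongr
  · obtain ⟨z', -, he⟩ := hγ.invariant ⟨z, hsub hz, rfl⟩
    simp only at he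
    rw [← he]

/-- The perturbation of the unit translation induced by `F` on the curve, in the coordinate
`U = -1/z`. -/
noncomputable def curveShift (F : ℂ × ℂ ≃ ℂ × ℂ) (γ : ℂ → ℂ) (U : ℂ) : ℂ :=
  shiftError F (-1 / U) (γ (-1 / U))

/-- The point of the curve with coordinate `U = -1/z`. -/
noncomputable def curvePt (γ : ℂ → ℂ) (U : ℂ) : ℂ × ℂ := (-1 / U, γ (-1 / U))

theorem coneRegion_re_pos {R : ℝ} (hR : 0 ≤ R) {U : ℂ} (hU : U ∈ coneRegion R) : 0 < U.re :=
  hR.trans_lt hU.1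

theorem coneRegion_ne_zero {R : ℝ} (hR : 0 ≤ R) {U : ℂ} (hU : U ∈ coneRegion R) : U ≠ 0 := by
  rintro rfl
  simpa using coneRegion_re_pos hR hU

theorem neg_one_div_mem_sector {R : ℝ} (hR : 0 < R) {U : ℂ} (hU : U ∈ coneRegion R) :
    -1 / U ∈ sector (1 / R) := by
  refine (neg_one_div_mem_sector_iff (by positivity)).2 ⟨?_, hU.2⟩
  rw [one_div_one_div]
  exact hU.1.trans_le (Complex.re_le_norm U)

theorem norm_neg_one_div_le {R : ℝ} (hR : 0 ≤ R) {U : ℂ} (hU : U ∈ coneRegion R) :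
    ‖-1 / U‖ ≤ 1 / U.re := by
  have := coneRegion_re_pos hR hU
  rw [norm_div, norm_neg, norm_one]
  exact one_div_le_one_div_of_le this (Complex.re_le_norm U)

section
variable {F : ℂ × ℂ ≃ ℂ × ℂ} {γ : ℂ → ℂ} {M r C R : ℝ}

theorem CurveControl.thousand_le (hL : LocalBounds F M r) (h : CurveControl F γ M r C R) :
    1000 ≤ R ∧ 1000 * M ≤ R ∧ 1000 * C ≤ R := by
  have h1 := hL.one_le
  have h2 := h.one_le
  have h3 := h.large
  refine ⟨?_, ?_, ?_⟩ <;> nlinarith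

theorem CurveControl.norm_le_of_mem (hL : LocalBounds F M r) (h : CurveControl F γ M r C R) {z : ℂ}
    (hz : z ∈ sector (1 / R)) : ‖z‖ ≤ r / 4 ∧ C * ‖z‖ ≤ 1 / 1000 ∧ M * ‖z‖ ≤ 1 / 1000 ∧
      M * C * ‖z‖ ≤ 1 / 1000 ∧ ‖z‖ ≤ 1 / 1000 ∧ ‖γ z‖ ≤ ‖z‖ ^ 2 ∧ ‖γ z‖ ≤ ‖z‖ := by
  obtain ⟨h1, h2, h3⟩ := h.thousand_le hL
  have hlt := hz.2.1.le
  have hR0 : 0 < R := by linarith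
  have hC := h.one_le
  have hM := hL.one_le
  have hz0 := norm_nonneg z
  have hzR : ‖z‖ * R ≤ 1 := by rwa [le_div_iff₀ hR0] at hlt
  have hl := h.large
  have hr := h.radius
  have hCz : C * ‖z‖ ≤ 1 / 1000 := by nlinarith
  have hz1 : ‖z‖ ≤ 1 / 1000 := by nlinarith
  have hγ : ‖γ z‖ ≤ ‖z‖ ^ 2 := by
    refine (h.size z hz).trans ?_
    have : C * ‖z‖ ^ 3 = C * ‖z‖ * ‖z‖ ^ 2 := by ring
    rw [this]
    nlinarith [sq_nonneg ‖z‖]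
  refine ⟨?_, hCz, by nlinarith, by nlinarith, hz1, hγ, by nlinarith⟩
  have hr0 := hL.pos
  have : ‖z‖ * 4 ≤ ‖z‖ * (r * R) := by gcongr
  nlinarith

theorem CurveControl.isPerturbedTranslation (hF : Differentiable ℂ F) (hL : LocalBounds F M r)
    (h : CurveControl F γ M r C R) :
    IsPerturbedTranslation (curveShift F γ) (2 * M * C) R := by
  obtain ⟨hR1, hR2, hR3⟩ := h.thousand_le hL
  have hR0 : 0 < R := by linarith
  have hC := h.one_le
  have hM := hL.one_le
  have hl := h.large
  have hr := hL.pos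
  have hdecay : ∀ U ∈ coneRegion R, ‖curveShift F γ U‖ ≤ 2 * M * ‖-1 / U‖ := by
    intro U hU
    have hz := neg_one_div_mem_sector hR0 hU
    obtain ⟨b1, b2, b3, b4, b5, b6, b7⟩ := h.norm_le_of_mem hL hz
    refine (hL.shift_bound _ _ (ne_zero_of_mem_sector hz) (by linarith) (by linarith)).trans ?_
    nlinarith
  refine ⟨by nlinarith, by nlinarith, fun U hU => ?_, fun U hU => ?_, fun U hU => ?_,
    fun U hU U' hU' => ?_⟩
  · have hz := neg_one_div_mem_sector hR0 hU
    obtain ⟨b1, b2, b3, b4, b5, b6, b7⟩ := h.norm_le_of_mem hL hz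
    have hz0 := ne_zero_of_mem_sector hz
    have d1 : DifferentiableAt ℂ (fun U : ℂ => -1 / U) U :=
      (differentiableAt_const _).div differentiableAt_id (coneRegion_ne_zero hR0.le hU)
    have d2 : DifferentiableAt ℂ (fun U : ℂ => γ (-1 / U)) U :=
      (h.diff.differentiableAt ((isOpen_sector _).mem_nhds hz)).comp U d1
    exact (differentiableAt_shiftError hF d1 d2 hz0
      (hL.fst_ne _ _ hz0 (by linarith) (by linarith))).differentiableWithinAt
  · have hz := neg_one_div_mem_sector hR0 hU
    obtain ⟨b1, b2, b3, b4, b5, b6, b7⟩ := h.norm_le_of_mem hL hz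
    refine (hdecay U hU).trans ?_
    linarith
  · refine (hdecay U hU).trans ?_
    have := norm_neg_one_div_le hR0.le hU
    have hre := coneRegion_re_pos hR0.le hU
    calc 2 * M * ‖-1 / U‖ ≤ 2 * M * (1 / U.re) := by gcongr
      _ = 2 * M * 1 / U.re := by ring
      _ ≤ _ := by gcongr
  · have hz := neg_one_div_mem_sector hR0 hU
    have hz' := neg_one_div_mem_sector hR0 hU'
    obtain ⟨b1, b2, b3, b4, b5, b6, b7⟩ := h.norm_le_of_mem hL hz
    obtain ⟨b1', b2', b3', b4', b5', b6', b7'⟩ := h.norm_le_of_mem hL hz'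
    refine (hL.shift_lip _ _ _ _ (ne_zero_of_mem_sector hz) (ne_zero_of_mem_sector hz')
      (by linarith) (by linarith) (by linarith) (by linarith)).trans ?_
    have h1 := h.lip (1 / R) le_rfl _ hz _ hz'
    have h2 : C * (1 / R) ^ 2 ≤ C := by
      have : 1 / R ≤ 1 := by rw [div_le_one hR0]; linarith
      have : (1 / R) ^ 2 ≤ 1 := pow_le_one₀ (by positivity) this
      nlinarith
    have hre := coneRegion_re_pos hR0.le hU
    have hre' := coneRegion_re_pos hR0.le hU'
    have h3 : ‖-1 / U - -1 / U'‖ ≤ ‖U - U'‖ / (U.re * U'.re) := by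
      have e : -1 / U - -1 / U' = (U - U') / (U * U') := by
        have := coneRegion_ne_zero hR0.le hU
        have := coneRegion_ne_zero hR0.le hU'
        field_simp
        ring
      rw [e, norm_div, norm_mul]
      gcongr
      · exact Complex.re_le_norm U
      · exact Complex.re_le_norm U'
    have h4 := norm_nonneg (-1 / U - -1 / U')
    calc M * (‖-1 / U - -1 / U'‖ + ‖γ (-1 / U) - γ (-1 / U')‖)
        ≤ M * (C * ‖-1 / U - -1 / U'‖ + C * ‖-1 / U - -1 / U'‖) := by
          gcongr
          · nlinarith
          · exact h1.trans (by gcongr)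
      _ = 2 * M * C * ‖-1 / U - -1 / U'‖ := by ring
      _ ≤ 2 * M * C * (‖U - U'‖ / (U.re * U'.re)) := by gcongr
      _ = _ := by ring

theorem CurveControl.map_curvePt (hL : LocalBounds F M r)
    (h : CurveControl F γ M r C R) {U : ℂ} (hU : U ∈ coneRegion R) :
    F (curvePt γ U) = curvePt γ (shiftMap (curveShift F γ) U) := by
  have hR0 : 0 < R := by have := (h.thousand_le hL).1; linarith
  have h1 : -1 / (F (curvePt γ U)).1 = shiftMap (curveShift F γ) U := by
    rw [curvePt, shift_eq, neg_one_div_neg_one_div, shiftMap, curveShift]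
  have h2 : (F (curvePt γ U)).1 = -1 / shiftMap (curveShift F γ) U := by
    rw [← h1, neg_one_div_neg_one_div]
  have h3 : (F (curvePt γ U)).2 = γ (F (curvePt γ U)).1 :=
    h.inv _ (neg_one_div_mem_sector hR0 hU)
  ext1
  · exact h2
  · rw [h3, h2]; rfl

theorem CurveControl.iterate_curvePt (hF : Differentiable ℂ F) (hL : LocalBounds F M r)
    (h : CurveControl F γ M r C R) {U : ℂ} (hU : U ∈ coneRegion R) (n : ℕ) :
    F^[n] (curvePt γ U) = curvePt γ ((shiftMap (curveShift F γ))^[n] U) := by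
  induction n with
  | zero => rfl
  | succ n ih =>
    rw [Function.iterate_succ_apply', ih, Function.iterate_succ_apply',
      h.map_curvePt hL ((h.isPerturbedTranslation hF hL).iterate_mem hU n).1]

theorem mem_coneRegion_of_sector {R ε : ℝ} (hR : 0 < R) (hε : ε ≤ 1 / (2 * R)) {z : ℂ}
    (hz : z ∈ sector ε) : -1 / z ∈ coneRegion R := by
  have hε0 : 0 < ε := hz.1.trans hz.2.1
  have hz' : -1 / (-1 / z) ∈ sector ε := by rwa [neg_one_div_neg_one_div]
  obtain ⟨h1, h2⟩ := (neg_one_div_mem_sector_iff hε0).1 hz'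
  have h3 : 2 * R ≤ 1 / ε := by rwa [le_one_div (by positivity) hε0]
  have := norm_le_of_slope h2.le
  exact ⟨by linarith, h2⟩

/-- Orbits on the curve enter every small sector. -/
theorem CurveControl.exists_iterate_mem_sector (hF : Differentiable ℂ F) (hL : LocalBounds F M r)
    (h : CurveControl F γ M r C R) {ε : ℝ} (hε : 0 < ε) {U : ℂ} (hU : U ∈ coneRegion R) :
    ∃ n : ℕ, -1 / (shiftMap (curveShift F γ))^[n] U ∈ sector ε := by
  have hR0 : 0 < R := by have := (h.thousand_le hL).1; linarith
  obtain ⟨n, hn⟩ := exists_nat_gt (2 * (1 / ε))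
  obtain ⟨h1, h2, -⟩ := (h.isPerturbedTranslation hF hL).iterate_mem hU n
  refine ⟨n, (neg_one_div_mem_sector_iff hε).2 ⟨?_, h1.2⟩⟩
  have := coneRegion_re_pos hR0.le hU
  have := Complex.re_le_norm ((shiftMap (curveShift F γ))^[n] U)
  have : 0 < 1 / ε := by positivity
  linarith

/-! ### Uniformization of the global curve -/

theorem iterate_symm_iterate (F : ℂ × ℂ ≃ ℂ × ℂ) (n : ℕ) (p : ℂ × ℂ) :
    F^[n] (F.symm^[n] p) = p :=
  Function.LeftInverse.iterate (f := F.symm) (g := F) F.apply_symm_apply n p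

theorem symm_iterate_iterate (F : ℂ × ℂ ≃ ℂ × ℂ) (n : ℕ) (p : ℂ × ℂ) :
    F.symm^[n] (F^[n] p) = p :=
  Function.LeftInverse.iterate (f := F) (g := F.symm) F.symm_apply_apply n p

theorem CurveControl.biholomorphic (hF : Differentiable ℂ F) (hF' : Differentiable ℂ F.symm)
    (hL : LocalBounds F M r) (h : CurveControl F γ M r C R) {ε : ℝ} (hε : 0 < ε)
    (hεR : ε ≤ 1 / (2 * R)) : BigCurveBiholomorphicToPlane F γ ε := by
  have hR0 : 0 < R := by have := (h.thousand_le hL).1; linarith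
  have hκ := h.isPerturbedTranslation hF hL
  obtain ⟨φ, hφd, hφ1, hφ2⟩ := hκ.exists_fatou
  obtain ⟨ψ, hψ, hψ'⟩ := exists_inverse_of_near_id (isOpen_coneRegion R) hφd hφ2
  set g := shiftMap (curveShift F γ) with hg
  have hφn : ∀ U ∈ coneRegion R, ∀ n : ℕ, φ (g^[n] U) = φ U + n := by
    intro U hU n
    induction n with
    | zero => simp
    | succ n ih =>
      rw [Function.iterate_succ_apply', hφ1 _ (hκ.iterate_mem hU n).1, ih]
      push_cast
      ring
  have hinj : ∀ U ∈ coneRegion R, ∀ V ∈ coneRegion R, φ U = φ V → U = V := by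
    intro U hU V hV he
    rw [← hψ U hU, he, hψ V hV]
  -- the point `F⁻ⁿ(z, γ z)` depends only on the value `φ U - n`
  have hwell : ∀ U ∈ coneRegion R, ∀ V ∈ coneRegion R, ∀ n m : ℕ, φ U - n = φ V - m →
      F.symm^[n] (curvePt γ U) = F.symm^[m] (curvePt γ V) := by
    have aux : ∀ U ∈ coneRegion R, ∀ V ∈ coneRegion R, ∀ n j : ℕ, φ U - n = φ V - (n + j : ℕ) →
        F.symm^[n] (curvePt γ U) = F.symm^[n + j] (curvePt γ V) := by
      intro U hU V hV n j he
      have h1 : g^[j] U = V := by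
        apply hinj _ (hκ.iterate_mem hU j).1 _ hV
        rw [hφn U hU j]
        push_cast at he
        linear_combination he
      rw [← h1, ← h.iterate_curvePt hF hL hU j, Function.iterate_add_apply, symm_iterate_iterate]
    intro U hU V hV n m he
    rcases le_total n m with hnm | hnm
    · obtain ⟨j, rfl⟩ := Nat.exists_eq_add_of_le hnm
      exact aux U hU V hV n j he
    · obtain ⟨j, rfl⟩ := Nat.exists_eq_add_of_le hnm
      exact (aux V hV U hU m j he.symm).symm
  choose N P hP hPφ using hκ.exists_fatou_eq hφ1 hφ2
  set H : ℂ → ℂ × ℂ := fun t => F.symm^[N t] (curvePt γ (P t)) with hH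
  have hHeq : ∀ U ∈ coneRegion R, ∀ n : ℕ, H (φ U - n) = F.symm^[n] (curvePt γ U) := by
    intro U hU n
    refine hwell _ (hP _) U hU _ _ ?_
    rw [hPφ]
    ring
  have hHinj : Function.Injective H := by
    intro s t he
    have h1 := congrArg (F^[N t + N s]) he
    simp only [hH] at h1
    rw [Function.iterate_add_apply, iterate_symm_iterate, add_comm (N t),
      Function.iterate_add_apply, iterate_symm_iterate, h.iterate_curvePt hF hL (hP s), h.iterate_curvePt hF hL (hP t)] at h1
    have h2 := congrArg (fun p : ℂ × ℂ => -1 / p.1) h1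
    simp only [curvePt, neg_one_div_neg_one_div] at h2
    have h3 := congrArg φ h2
    rw [hφn _ (hP s), hφn _ (hP t), hPφ, hPφ] at h3
    linear_combination h3
  have hleft := Function.leftInverse_invFun hHinj
  refine ⟨H, Function.invFun H, ?_, ?_, hleft, ?_⟩
  · intro t
    -- near `t` the index `N t` may be kept, and the point is found with the inverse of `φ`
    obtain ⟨h1, h2⟩ := hψ' (P t) (hP t)
    rw [hPφ] at h1 h2
    have h3 : ∀ᶠ s : ℂ in 𝓝 t, s + (N t : ℂ) ∈ φ '' coneRegion R :=
      (continuous_add_const (N t : ℂ)).continuousAt.eventually h1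
    have h4 : H =ᶠ[𝓝 t] fun s => F.symm^[N t] (curvePt γ (ψ (s + N t))) := by
      filter_upwards [h3] with s hs
      obtain ⟨U, hU, he⟩ := hs
      rw [← he, hψ U hU, ← hHeq U hU, he, add_sub_cancel_right]
    have e5 : ψ (t + N t) = P t := by rw [← hPφ, hψ _ (hP t)]
    have d1 : DifferentiableAt ℂ (fun s => ψ (s + N t)) t :=
      DifferentiableAt.comp t h2 (differentiableAt_id.add_const _)
    have d2 : DifferentiableAt ℂ (fun s => -1 / ψ (s + N t)) t :=
      (differentiableAt_const _).div d1 (by rw [e5]; exact coneRegion_ne_zero hR0.le (hP t))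
    have d3 : DifferentiableAt ℂ γ (-1 / ψ (t + N t)) := by
      rw [e5]
      exact h.diff.differentiableAt
        ((isOpen_sector _).mem_nhds (neg_one_div_mem_sector hR0 (hP t)))
    have d4 : DifferentiableAt ℂ (fun s => curvePt γ (ψ (s + N t))) t :=
      d2.prodMk (d3.comp t d2)
    exact (((hF'.iterate (N t)) _).comp t d4).congr_of_eventuallyEq h4
  · ext p
    constructor
    · rintro ⟨t, rfl⟩
      obtain ⟨j, hj⟩ := h.exists_iterate_mem_sector hF hL hε (hP t)
      refine Set.mem_iUnion.2 ⟨j + N t, -1 / g^[j] (P t), hj, ?_⟩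
      simp only [hH]
      rw [Function.iterate_add_apply, iterate_symm_iterate, h.iterate_curvePt hF hL (hP t)]
      rfl
    · intro hp
      obtain ⟨n, z, hz, he⟩ := Set.mem_iUnion.1 hp
      have hU := mem_coneRegion_of_sector hR0 hεR hz
      refine ⟨φ (-1 / z) - n, ?_⟩
      rw [hHeq _ hU, curvePt, neg_one_div_neg_one_div, ← symm_iterate_iterate F n p, ← he]
  · intro n
    have h1 : DifferentiableOn ℂ (fun z => φ (-1 / z) - n) (sector ε) := by
      refine DifferentiableOn.sub_const (DifferentiableOn.comp hφd (fun z hz => ?_)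
        fun z hz => mem_coneRegion_of_sector hR0 hεR hz) _
      exact ((differentiableAt_const _).div differentiableAt_id
        (ne_zero_of_mem_sector hz)).differentiableWithinAt
    refine h1.congr fun z hz => ?_
    have h2 := hHeq _ (mem_coneRegion_of_sector hR0 hεR hz) n
    rw [curvePt, neg_one_div_neg_one_div] at h2
    rw [← h2, hleft]

end

/-! ### Dynamics transverse to the curve -/

/-- The vertical distance `w - γ z` of a point from the curve. -/
def offset (γ : ℂ → ℂ) (p : ℂ × ℂ) : ℂ := p.2 - γ p.1

section
variable {F : ℂ × ℂ ≃ ℂ × ℂ} {γ : ℂ → ℂ} {M r C R : ℝ}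

theorem CurveControl.fst_step (hL : LocalBounds F M r) (h : CurveControl F γ M r C R)
    {z v : ℂ} (hz : z ∈ sector (1 / R)) (hv : ‖v‖ ≤ r / 4) (hMv : M * ‖v‖ ≤ 1 / 1000) :
    ∃ e : ℂ, ‖e‖ ≤ 1 / 10 ∧ (F (z, γ z + v)).1 = -1 / (-1 / z + 1 + e) := by
  obtain ⟨b1, b2, b3, b4, b5, b6, b7⟩ := h.norm_le_of_mem hL hz
  have hM := hL.one_le
  have hr := hL.pos
  have hγv := norm_add_le (γ z) v
  refine ⟨shiftError F z (γ z + v), ?_, ?_⟩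
  · refine (hL.shift_bound _ _ (ne_zero_of_mem_sector hz) (by linarith) (by linarith)).trans ?_
    have : M * (‖z‖ + ‖γ z + v‖) ≤ M * (‖z‖ + (‖z‖ + ‖v‖)) := by gcongr; linarith
    linarith
  · rw [← shift_eq, neg_one_div_neg_one_div]

theorem sector_step {ε : ℝ} {z e : ℂ} (hz : z ∈ sector ε) (he : ‖e‖ ≤ 1 / 10) :
    -1 / (-1 / z + 1 + e) ∈ sector ε ∧ -1 / (-1 / z + 1 + e) ∈ sector ‖z‖ ∧
      (-1 / z).re + 9 / 10 ≤ (-1 / z + 1 + e).re ∧ ‖-1 / z‖ + 7 / 10 ≤ ‖-1 / z + 1 + e‖ := by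
  have hε : 0 < ε := hz.1.trans hz.2.1
  have hz' : -1 / (-1 / z) ∈ sector ε := by rwa [neg_one_div_neg_one_div]
  obtain ⟨h1, h2⟩ := (neg_one_div_mem_sector_iff hε).1 hz'
  have h3 := abs_im_lt_step h2 he
  have h4 := norm_step h2 he
  have h5 : ‖-1 / z‖ = 1 / ‖z‖ := by rw [norm_div, norm_neg, norm_one]
  exact ⟨(neg_one_div_mem_sector_iff hε).2 ⟨by linarith, h3.1⟩,
    (neg_one_div_mem_sector_iff hz.1).2 ⟨by linarith, h3.1⟩, h3.2, h4⟩

/-- The leading term of the dynamics transverse to the curve: `v` is mapped to `v - z v²`, up to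
an error of higher order. -/
theorem CurveControl.offset_step (hL : LocalBounds F M r) (h : CurveControl F γ M r C R)
    {z v : ℂ} (hz : z ∈ sector (1 / R)) (hv : ‖v‖ ≤ r / 4) (hMv : M * ‖v‖ ≤ 1 / 1000) :
    ‖offset γ (F (z, γ z + v)) - v + z * v ^ 2‖ ≤ 4 * M * ‖z‖ * ‖v‖ * (‖z‖ + ‖v‖) ^ 2 := by
  obtain ⟨b1, b2, b3, b4, b5, b6, b7⟩ := h.norm_le_of_mem hL hz
  have hM := hL.one_le
  have hC := h.one_le
  have hr := hL.pos
  have hz0 := ne_zero_of_mem_sector hz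
  have hγv := norm_add_le (γ z) v
  have hzn := norm_nonneg z
  have hvn := norm_nonneg v
  obtain ⟨e, he, h1⟩ := h.fst_step hL hz hv hMv
  obtain ⟨e', he', h1'⟩ := h.fst_step hL (v := 0) hz (by simpa using by linarith)
    (by rw [norm_zero]; norm_num)
  rw [add_zero] at h1'
  have hs : (F (z, γ z + v)).1 ∈ sector ‖z‖ := by rw [h1]; exact (sector_step hz he).2.1
  have hs' : (F (z, γ z)).1 ∈ sector ‖z‖ := by rw [h1']; exact (sector_step hz he').2.1
  have hlip := h.lip ‖z‖ hz.2.1.le _ hs _ hs'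
  have hfst := hL.fst_lip z (γ z + v) (γ z) hz0 (by linarith) (by linarith) (by linarith)
  rw [add_sub_cancel_left] at hfst
  have hsnd := hL.snd_lip (‖z‖ + ‖v‖) (by linarith) z (γ z + v) z (γ z) hz0 hz0 (by linarith)
    (by linarith) (by linarith) (by linarith)
  rw [sub_self, norm_zero, zero_add, add_sub_cancel_left] at hsnd
  have hinv := h.inv z hz
  have e1 : offset γ (F (z, γ z + v)) - v + z * v ^ 2 = -(2 * z * γ z * v) +
      z * (sndError F z (γ z + v) - sndError F z (γ z)) -
      (γ (F (z, γ z + v)).1 - γ (F (z, γ z)).1) := by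
    rw [← hinv, offset, snd_eq F _ hz0, snd_eq F _ hz0]
    ring
  have c1 : ‖2 * z * γ z * v‖ ≤ 2 * ‖z‖ * ‖v‖ * (‖z‖ + ‖v‖) ^ 2 := by
    rw [norm_mul, norm_mul, norm_mul, Complex.norm_two]
    calc 2 * ‖z‖ * ‖γ z‖ * ‖v‖ ≤ 2 * ‖z‖ * (‖z‖ + ‖v‖) ^ 2 * ‖v‖ := by
          gcongr
          refine b6.trans ?_
          gcongr
          linarith
      _ = _ := by ring
  have c2 : ‖z * (sndError F z (γ z + v) - sndError F z (γ z))‖ ≤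
      M * ‖z‖ * ‖v‖ * (‖z‖ + ‖v‖) ^ 2 := by
    rw [norm_mul]
    calc ‖z‖ * ‖sndError F z (γ z + v) - sndError F z (γ z)‖
        ≤ ‖z‖ * (M * (‖z‖ + ‖v‖) ^ 2 * ‖v‖) := by gcongr
      _ = _ := by ring
  have c3 : ‖γ (F (z, γ z + v)).1 - γ (F (z, γ z)).1‖ ≤ ‖z‖ * ‖v‖ * (‖z‖ + ‖v‖) ^ 2 := by
    refine hlip.trans ?_
    calc C * ‖z‖ ^ 2 * ‖(F (z, γ z + v)).1 - (F (z, γ z)).1‖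
        ≤ C * ‖z‖ ^ 2 * (M * ‖z‖ ^ 2 * ‖v‖) := by gcongr
      _ = M * C * ‖z‖ * (‖z‖ * ‖v‖ * ‖z‖ ^ 2) := by ring
      _ ≤ 1 * (‖z‖ * ‖v‖ * (‖z‖ + ‖v‖) ^ 2) := by
        gcongr
        · linarith
        · linarith
      _ = _ := one_mul _
  rw [e1]
  have tri : ‖-(2 * z * γ z * v) + z * (sndError F z (γ z + v) - sndError F z (γ z)) -
      (γ (F (z, γ z + v)).1 - γ (F (z, γ z)).1)‖ ≤ ‖2 * z * γ z * v‖ +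
      ‖z * (sndError F z (γ z + v) - sndError F z (γ z))‖ +
      ‖γ (F (z, γ z + v)).1 - γ (F (z, γ z)).1‖ := by
    refine (norm_sub_le _ _).trans (add_le_add_left ((norm_add_le _ _).trans_eq ?_) _)
    rw [norm_neg]
  have hX : 0 ≤ ‖z‖ * ‖v‖ * (‖z‖ + ‖v‖) ^ 2 := by positivity
  have := mul_le_mul_of_nonneg_right hM hX
  linarith

/-! ### The global curve does not meet the basin -/

/-- A forward invariant region off the curve: `U = -1/z` lies in the narrow cone, `Y = -1/v` lies
far out in the cone `|Im Y| < Re Y`, and `|Y| < |U|`. -/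
def escapeRegion (γ : ℂ → ℂ) (R : ℝ) : Set (ℂ × ℂ) :=
  {p | p.1 ∈ sector (1 / R) ∧ offset γ p ≠ 0 ∧ R < (-1 / offset γ p).re ∧
    |(-1 / offset γ p).im| < (-1 / offset γ p).re ∧ ‖-1 / offset γ p‖ < ‖-1 / p.1‖}

/-- Where `|z| ≤ |v|`, the coordinate `Y = -1/v` moves by approximately `-z`. -/
theorem neg_one_div_step {M : ℝ} {z v v' : ℂ} (hv0 : v ≠ 0) (hzv : ‖z‖ ≤ ‖v‖)
    (hMv : M * ‖v‖ ≤ 1 / 1000) (hv1 : ‖v‖ ≤ 1 / 1000) (hM : 1 ≤ M)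
    (hstep : ‖v' - v + z * v ^ 2‖ ≤ 4 * M * ‖z‖ * ‖v‖ * (‖z‖ + ‖v‖) ^ 2) :
    v' ≠ 0 ∧ ∃ η : ℂ, -1 / v' = -1 / v + (-z + η) ∧ ‖η‖ ≤ ‖z‖ / 20 := by
  have hvn : 0 < ‖v‖ := norm_pos_iff.2 hv0
  have hzn := norm_nonneg z
  -- `v' = v (1 - z v + θ)` with `θ` small compared with `z v`
  set θ := (v' - v + z * v ^ 2) / v with hθ
  have hθn : ‖θ‖ ≤ 16 * M * ‖z‖ * ‖v‖ ^ 2 := by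
    rw [hθ, norm_div, div_le_iff₀ hvn]
    refine hstep.trans ?_
    calc 4 * M * ‖z‖ * ‖v‖ * (‖z‖ + ‖v‖) ^ 2 ≤ 4 * M * ‖z‖ * ‖v‖ * (‖v‖ + ‖v‖) ^ 2 := by gcongr
      _ = _ := by ring
  have hD : v' = v * (1 - z * v + θ) := by rw [hθ]; field_simp; ring
  have hθ1 : ‖θ‖ ≤ 16 / 1000 * (‖z‖ * ‖v‖) := by
    refine hθn.trans ?_
    have := mul_le_mul_of_nonneg_right hMv (show 0 ≤ ‖z‖ * ‖v‖ by positivity)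
    nlinarith
  set D := 1 - z * v + θ with hDdef
  have hD1 : ‖D - 1‖ ≤ 2 / 1000 := by
    have e1 : D - 1 = -(z * v) + θ := by rw [hDdef]; ring
    rw [e1]
    refine (norm_add_le _ _).trans ?_
    rw [norm_neg, norm_mul]
    nlinarith
  have hDn : 998 / 1000 ≤ ‖D‖ := by
    have := norm_sub_norm_le 1 (1 - D)
    rw [norm_sub_rev, sub_sub_cancel, norm_one] at this
    linarith
  have hD0 : D ≠ 0 := norm_pos_iff.1 (by linarith)
  have hv'0 : v' ≠ 0 := by rw [hD]; exact mul_ne_zero hv0 hD0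
  set η := (θ / v + z * (D - 1)) / D with hη
  have hYeq : -1 / v' = -1 / v + (-z + η) := by
    rw [hD, hη]
    have e2 : θ = D - 1 + z * v := by rw [hDdef]; ring
    rw [e2]
    field_simp
    ring
  have hηn : ‖η‖ ≤ ‖z‖ / 20 := by
    rw [hη, norm_div, div_le_iff₀ (by linarith)]
    refine (norm_add_le _ _).trans ?_
    rw [norm_div, norm_mul]
    have d1 : ‖θ‖ / ‖v‖ ≤ 16 / 1000 * ‖z‖ := by
      rw [div_le_iff₀ hvn]; linarith
    have d2 : ‖z‖ * ‖D - 1‖ ≤ ‖z‖ * (2 / 1000) := by gcongr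
    have d3 : ‖z‖ / 20 * (998 / 1000) ≤ ‖z‖ / 20 * ‖D‖ := by gcongr
    linarith
  exact ⟨hv'0, η, hYeq, hηn⟩

theorem CurveControl.mapsTo_escapeRegion (hL : LocalBounds F M r)
    (h : CurveControl F γ M r C R) : Set.MapsTo F (escapeRegion γ R) (escapeRegion γ R) := by
  rintro ⟨z, w⟩ ⟨hz, hv0, hre, him, hlt⟩
  simp only at hz hlt
  obtain ⟨b1, b2, b3, b4, b5, b6, b7⟩ := h.norm_le_of_mem hL hz
  obtain ⟨hR1, hR2, hR3⟩ := h.thousand_le hL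
  have hM := hL.one_le
  have hr := hL.pos
  have hz0 := ne_zero_of_mem_sector hz
  have hR0 : 0 < R := by linarith
  set v := offset γ (z, w) with hv
  have hw : w = γ z + v := by rw [hv, offset]; ring
  have hvn : 0 < ‖v‖ := norm_pos_iff.2 hv0
  have hzn : 0 < ‖z‖ := norm_pos_iff.2 hz0
  have hY : ‖-1 / v‖ = 1 / ‖v‖ := by rw [norm_div, norm_neg, norm_one]
  have hU : ‖-1 / z‖ = 1 / ‖z‖ := by rw [norm_div, norm_neg, norm_one]
  have hzv : ‖z‖ < ‖v‖ := by rwa [hY, hU, one_div_lt_one_div hvn hzn] at hlt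
  have hvR : ‖v‖ * R ≤ 1 := by
    have h1 := hre.trans_le (Complex.re_le_norm _)
    rw [hY, lt_div_iff₀ hvn] at h1
    linarith
  have hvr : ‖v‖ ≤ r / 4 := by
    have h1 : ‖v‖ * 4 ≤ ‖v‖ * (r * R) := mul_le_mul_of_nonneg_left h.radius hvn.le
    nlinarith
  have hMv : M * ‖v‖ ≤ 1 / 1000 := by nlinarith
  have hv1 : ‖v‖ ≤ 1 / 1000 := by nlinarith
  obtain ⟨e, he, h1⟩ := h.fst_step hL hz hvr hMv
  obtain ⟨s1, -, s3, s4⟩ := sector_step hz he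
  have hstep := h.offset_step hL hz hvr hMv
  rw [← hw] at h1 hstep
  set v' := offset γ (F (z, w)) with hv'
  obtain ⟨hv'0, η, hYeq, hηn⟩ := neg_one_div_step hv0 hzv.le hMv hv1 hM hstep
  have hzs := (mem_sector_iff.1 hz).2
  have hzn' : ‖-z‖ ≤ 9 / 8 * (-z).re := norm_le_of_slope (by simpa using hzs.le)
  rw [norm_neg, Complex.neg_re] at hzn'
  have f1 := (Complex.abs_re_le_norm η).trans hηn
  have f2 := (Complex.abs_im_le_norm η).trans hηn
  have g1 : (-1 / v').re = (-1 / v).re + (-z.re + η.re) := by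
    rw [hYeq]; simp only [Complex.add_re, Complex.neg_re]
  have g2 : (-1 / v').im = (-1 / v).im + (-z.im + η.im) := by
    rw [hYeq]; simp only [Complex.add_im, Complex.neg_im]
  have f3 := (abs_le.1 f1).1
  have f4 : |(-1 / v').im| ≤ |(-1 / v).im| + (|z.im| + |η.im|) := by
    rw [g2]
    refine (abs_add_le _ _).trans (add_le_add_right ((abs_add_le _ _).trans_eq ?_) _)
    rw [abs_neg]
  have hτ := sectorSlope_bounds
  have hx : 0 ≤ -z.re := by linarith
  have f5 : |z.im| ≤ 1 / 2 * -z.re :=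
    hzs.le.trans (mul_le_mul_of_nonneg_right hτ.2.le hx)
  have f6 : ‖-1 / v'‖ ≤ ‖-1 / v‖ + (‖z‖ + ‖η‖) := by
    rw [hYeq]
    refine (norm_add_le _ _).trans (add_le_add_right ((norm_add_le _ _).trans_eq ?_) _)
    rw [norm_neg]
  refine ⟨?_, hv'0, ?_, ?_, ?_⟩
  · rw [h1]; exact s1
  · rw [g1]; linarith
  · refine f4.trans_lt ?_; rw [g1]; linarith
  · rw [h1, neg_one_div_neg_one_div]
    linarith

theorem localDomain_subset_escapeRegion {ε : ℝ} (hR : 0 < R) (hε : ε ≤ 1 / (2 * R)) :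
    localDomain γ ε ⊆ escapeRegion γ R := by
  rintro ⟨z, w⟩ ⟨hz, hv, hlt⟩
  have hY := mem_coneRegion_of_sector hR hε hv
  have hle : ε ≤ 1 / R := hε.trans (by gcongr; linarith)
  have hτ := sectorSlope_bounds
  have hre := coneRegion_re_pos hR.le hY
  refine ⟨sector_mono hle hz, ne_zero_of_mem_sector hv, hY.1, ?_, ?_⟩
  · have := hY.2
    change |(-1 / (w - γ z)).im| < (-1 / (w - γ z)).re
    nlinarith
  · change ‖-1 / (w - γ z)‖ < ‖-1 / z‖
    rw [norm_div, norm_div, norm_neg, norm_one]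
    exact one_div_lt_one_div_of_lt hz.1 hlt

theorem iterate_mem_of_mapsTo {S : Set (ℂ × ℂ)} (hS : Set.MapsTo F S S) {p : ℂ × ℂ} {n m : ℕ}
    (hnm : n ≤ m) (hp : F^[n] p ∈ S) : F^[m] p ∈ S := by
  obtain ⟨j, rfl⟩ := Nat.exists_eq_add_of_le hnm
  rw [add_comm, Function.iterate_add_apply]
  exact hS.iterate j hp

theorem CurveControl.notMem_basin (hL : LocalBounds F M r) (h : CurveControl F γ M r C R) {ε : ℝ}
    (hε : ε ≤ 1 / (2 * R)) (hC : Set.MapsTo F (graphCurve γ ε) (graphCurve γ ε)) {p : ℂ × ℂ}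
    (hp : p ∈ bigCurve F γ ε) : p ∉ basin F γ ε := by
  have hR0 : 0 < R := by have := (h.thousand_le hL).1; linarith
  intro hp'
  obtain ⟨n, hn⟩ := Set.mem_iUnion.1 hp
  obtain ⟨m, hm⟩ := Set.mem_iUnion.1 hp'
  have h1 := iterate_mem_of_mapsTo hC (le_max_left n m) hn
  have h2 := iterate_mem_of_mapsTo (h.mapsTo_escapeRegion hL) (le_max_right n m)
    (localDomain_subset_escapeRegion hR0 hε hm)
  obtain ⟨z, -, he⟩ := h1
  rw [← he] at h2
  exact h2.2.1 (sub_self _)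

/-! ### The curve is approached by the basin -/

/-- As long as the offset is dominated by `z`, an orbit starting at offset `-δ` keeps its first
coordinate in the sector and its offset close to `-δ`. -/
theorem CurveControl.offset_orbit (hL : LocalBounds F M r) (h : CurveControl F γ M r C R)
    {ε δ : ℝ} (hε : ε ≤ 1 / (2 * R)) (hδ : 0 < δ) {z : ℂ} (hz : z ∈ sector ε) (n : ℕ)
    (hle : ∀ j < n, ‖offset γ (F^[j] (z, γ z - δ))‖ ≤ ‖(F^[j] (z, γ z - δ)).1‖) :
    (F^[n] (z, γ z - δ)).1 ∈ sector ε ∧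
      R + 9 / 10 * n ≤ (-1 / (F^[n] (z, γ z - δ)).1).re ∧
      ‖offset γ (F^[n] (z, γ z - δ)) + δ‖ ≤ δ / 4 := by
  obtain ⟨hR1, hR2, hR3⟩ := h.thousand_le hL
  have hR0 : 0 < R := by linarith
  have hM := hL.one_le
  have hεR : ε ≤ 1 / R := hε.trans (by gcongr; linarith)
  have hsmall : ∀ m : ℕ, ∑ j ∈ Finset.range m, 10 * δ * (1 / (2 * R + (j : ℝ)) ^ 2) ≤ δ / 4 := by
    intro m
    rw [← Finset.mul_sum]
    have := sum_inv_sq_le (N := 2 * R) (by linarith) m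
    calc 10 * δ * ∑ j ∈ Finset.range m, 1 / (2 * R + (j : ℝ)) ^ 2
        ≤ 10 * δ * (2 / (2 * R)) := by gcongr
      _ = 10 / R * δ := by field_simp
      _ ≤ 1 / 4 * δ := by
        refine mul_le_mul_of_nonneg_right ?_ hδ.le
        rw [div_le_iff₀ hR0]; linarith
      _ = _ := by ring
  have key : (F^[n] (z, γ z - δ)).1 ∈ sector ε ∧
      R + 9 / 10 * n ≤ (-1 / (F^[n] (z, γ z - δ)).1).re ∧
      ‖offset γ (F^[n] (z, γ z - δ)) + δ‖ ≤
        ∑ j ∈ Finset.range n, 10 * δ * (1 / (2 * R + (j : ℝ)) ^ 2) := by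
    induction n with
    | zero =>
      refine ⟨hz, ?_, ?_⟩
      · have := (mem_coneRegion_of_sector hR0 hε hz).1
        simpa using this.le
      · simp [offset]
    | succ n ih =>
      obtain ⟨i1, i2, i3⟩ := ih fun j hj => hle j (hj.trans n.lt_succ_self)
      have hn := hle n n.lt_succ_self
      have i4 := i3.trans (hsmall n)
      rw [Function.iterate_succ_apply']
      set p := F^[n] (z, γ z - δ) with hp
      have hz1 := sector_mono hεR i1
      obtain ⟨b1, b2, b3, b4, b5, b6, b7⟩ := h.norm_le_of_mem hL hz1
      have hMv : M * ‖offset γ p‖ ≤ 1 / 1000 :=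
        (mul_le_mul_of_nonneg_left hn (by linarith)).trans b3
      have hpe : p = (p.1, γ p.1 + offset γ p) := by ext1 <;> simp [offset]
      obtain ⟨e, he, hfst⟩ := h.fst_step hL hz1 (hn.trans b1) hMv
      have hoff := h.offset_step hL hz1 (hn.trans b1) hMv
      rw [← hpe] at hfst hoff
      obtain ⟨s1, -, s3, -⟩ := sector_step i1 he
      have hvn := norm_nonneg (offset γ p)
      have hzn : 0 < ‖p.1‖ := i1.1
      have hvδ : ‖offset γ p‖ ≤ 5 / 4 * δ := by
        have := norm_sub_norm_le (offset γ p) (-(δ : ℂ))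
        rw [norm_neg, sub_neg_eq_add, Complex.norm_real, Real.norm_of_nonneg hδ.le] at this
        linarith
      have hzle : ‖p.1‖ ≤ 2 / (2 * R + n) := by
        have hn0 : (0 : ℝ) ≤ n := n.cast_nonneg
        have h1 := i2.trans (Complex.re_le_norm _)
        rw [norm_div, norm_neg, norm_one, le_div_iff₀ hzn] at h1
        rw [le_div_iff₀ (by linarith)]
        nlinarith
      have hchange : ‖offset γ (F p) - offset γ p‖ ≤ 10 * δ * (1 / (2 * R + (n : ℝ)) ^ 2) := by
        have e1 : offset γ (F p) - offset γ p = (offset γ (F p) - offset γ p +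
            p.1 * offset γ p ^ 2) - p.1 * offset γ p ^ 2 := by ring
        rw [e1]
        refine (norm_sub_le _ _).trans ?_
        rw [norm_mul p.1, norm_pow]
        have a1 : 4 * M * ‖p.1‖ * ‖offset γ p‖ * (‖p.1‖ + ‖offset γ p‖) ^ 2 ≤
            ‖offset γ p‖ * ‖p.1‖ ^ 2 := by
          calc 4 * M * ‖p.1‖ * ‖offset γ p‖ * (‖p.1‖ + ‖offset γ p‖) ^ 2
              ≤ 4 * M * ‖p.1‖ * ‖offset γ p‖ * (‖p.1‖ + ‖p.1‖) ^ 2 := by gcongr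
            _ = 16 * (M * ‖p.1‖) * (‖offset γ p‖ * ‖p.1‖ ^ 2) := by ring
            _ ≤ 16 * (1 / 1000) * (‖offset γ p‖ * ‖p.1‖ ^ 2) := by gcongr
            _ ≤ 1 * (‖offset γ p‖ * ‖p.1‖ ^ 2) := by gcongr; norm_num
            _ = _ := one_mul _
        have a2 : ‖p.1‖ * ‖offset γ p‖ ^ 2 ≤ ‖offset γ p‖ * ‖p.1‖ ^ 2 := by
          calc ‖p.1‖ * ‖offset γ p‖ ^ 2 = ‖offset γ p‖ * (‖p.1‖ * ‖offset γ p‖) := by ring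
            _ ≤ ‖offset γ p‖ * (‖p.1‖ * ‖p.1‖) := by gcongr
            _ = _ := by ring
        have a3 : ‖offset γ p‖ * ‖p.1‖ ^ 2 ≤ 5 / 4 * δ * (2 / (2 * R + n)) ^ 2 := by gcongr
        have a4 : 5 / 4 * δ * (2 / (2 * R + n)) ^ 2 * 2 = 10 * δ * (1 / (2 * R + (n : ℝ)) ^ 2) := by
          rw [div_pow]; ring
        linarith
      refine ⟨?_, ?_, ?_⟩
      · rw [hfst]; exact s1
      · rw [hfst, neg_one_div_neg_one_div]
        push_cast
        linarith
      · rw [Finset.sum_range_succ]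
        have := norm_add_le (offset γ p + δ) (offset γ (F p) - offset γ p)
        rw [add_comm (offset γ p) (δ : ℂ), add_add_sub_cancel] at this
        rw [add_comm (offset γ p) (δ : ℂ)] at i3
        rw [add_comm (offset γ (F p)) (δ : ℂ)]
        linarith
  exact ⟨key.1, key.2.1, key.2.2.trans (hsmall n)⟩

theorem CurveControl.mem_basin_of_offset (hL : LocalBounds F M r) (h : CurveControl F γ M r C R)
    {ε δ : ℝ} (hε : ε ≤ 1 / (2 * R)) (hδ : 0 < δ) (hδε : 2 * δ < ε) {z : ℂ} (hz : z ∈ sector ε) :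
    (z, γ z - δ) ∈ basin F γ ε := by
  have hR0 : 0 < R := by have := (h.thousand_le hL).1; linarith
  have hτ := sectorSlope_bounds
  have hlow : ∀ v : ℂ, ‖v + δ‖ ≤ δ / 4 → 3 / 4 * δ ≤ ‖v‖ := by
    intro v hv
    have := norm_sub_norm_le (δ : ℂ) (v + δ)
    rw [sub_add_cancel_right, norm_neg, Complex.norm_real, Real.norm_of_nonneg hδ.le] at this
    linarith
  -- the orbit cannot stay in `|v| ≤ |z|`, for `z` tends to `0` while `v` stays near `-δ`
  have hex : ∃ n : ℕ, ‖(F^[n] (z, γ z - δ)).1‖ < ‖offset γ (F^[n] (z, γ z - δ))‖ := by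
    by_contra hcon
    push Not at hcon
    obtain ⟨n, hn⟩ := exists_nat_gt (2 / δ)
    obtain ⟨h1, h2, h3⟩ := h.offset_orbit hL hε hδ hz n fun j _ => hcon j
    have h4 := (hlow _ h3).trans (hcon n)
    have h5 := h2.trans (Complex.re_le_norm _)
    rw [norm_div, norm_neg, norm_one, le_div_iff₀ h1.1] at h5
    rw [div_lt_iff₀ hδ] at hn
    have hn0 : (0 : ℝ) ≤ n := n.cast_nonneg
    have : (R + 9 / 10 * n) * (3 / 4 * δ) ≤ 1 := (by gcongr : _ ≤ _).trans h5
    nlinarith [mul_pos hR0 hδ]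
  classical
  have hfind := Nat.find_spec hex
  have hmin : ∀ j < Nat.find hex, ‖offset γ (F^[j] (z, γ z - δ))‖ ≤ ‖(F^[j] (z, γ z - δ)).1‖ :=
    fun j hj => not_lt.1 (Nat.find_min hex hj)
  obtain ⟨h1, -, h3⟩ := h.offset_orbit hL hε hδ hz _ hmin
  refine Set.mem_iUnion.2 ⟨Nat.find hex, h1, ?_, hfind⟩
  change offset γ _ ∈ sector ε
  set v := offset γ (F^[Nat.find hex] (z, γ z - δ))
  have h4 := (Complex.abs_re_le_norm _).trans h3
  have h5 := (Complex.abs_im_le_norm _).trans h3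
  rw [Complex.add_re, Complex.ofReal_re] at h4
  rw [Complex.add_im, Complex.ofReal_im, add_zero] at h5
  have h6 := (abs_le.1 h4).2
  have h7 := norm_sub_norm_le v (-(δ : ℂ))
  rw [norm_neg, sub_neg_eq_add, Complex.norm_real, Real.norm_of_nonneg hδ.le] at h7
  refine mem_sector_iff.2 ⟨by linarith, ?_⟩
  nlinarith

theorem CurveControl.mem_closure_basin (hL : LocalBounds F M r) (h : CurveControl F γ M r C R)
    {ε : ℝ} (hε : ε ≤ 1 / (2 * R)) {z : ℂ} (hz : z ∈ sector ε) :
    (z, γ z) ∈ closure (basin F γ ε) := by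
  have hε0 : 0 < ε := hz.1.trans hz.2.1
  have ht : Tendsto (fun δ : ℝ => (z, γ z - δ)) (𝓝[>] 0) (𝓝 (z, γ z)) := by
    have : Continuous fun δ : ℝ => (z, γ z - δ) := by fun_prop
    have := this.tendsto 0
    simp only [Complex.ofReal_zero, sub_zero] at this
    exact this.mono_left nhdsWithin_le_nhds
  refine mem_closure_of_tendsto ht ?_
  filter_upwards [Ioo_mem_nhdsGT (half_pos hε0)] with δ hδ
  exact h.mem_basin_of_offset hL hε hδ.1 (by linarith [hδ.2]) hz

theorem CurveControl.bigCurve_subset_frontier (hF' : Differentiable ℂ F.symm)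
    (hL : LocalBounds F M r) (h : CurveControl F γ M r C R) {ε : ℝ} (hε : ε ≤ 1 / (2 * R))
    (hC : Set.MapsTo F (graphCurve γ ε) (graphCurve γ ε)) :
    bigCurve F γ ε ⊆ frontier (basin F γ ε) := by
  intro p hp
  refine ⟨?_, fun hint => h.notMem_basin hL hε hC hp (interior_subset hint)⟩
  obtain ⟨m, z, hz, he⟩ := Set.mem_iUnion.1 hp
  have h1 := h.mem_closure_basin hL hε hz
  have h2 : Set.MapsTo (F.symm^[m]) (basin F γ ε) (basin F γ ε) := by
    intro q hq
    obtain ⟨n, hn⟩ := Set.mem_iUnion.1 hq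
    refine Set.mem_iUnion.2 ⟨n + m, ?_⟩
    rw [Set.mem_preimage, Function.iterate_add_apply, iterate_symm_iterate]
    exact hn
  have h3 := map_mem_closure (hF'.continuous.iterate m) h1 h2
  simp only at he
  rwa [he, symm_iterate_iterate] at h3

theorem CurveControl.isParabolicCurve_restrict (hF : Differentiable ℂ F) (hL : LocalBounds F M r)
    (h : CurveControl F γ M r C R) {ε ε₁ : ℝ} (hε : ε ≤ 1 / (2 * R))
    (hεε₁ : ε ≤ ε₁) (hγ : IsParabolicCurve F γ ε₁) : IsParabolicCurve F γ ε := by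
  have hR0 : 0 < R := by have := (h.thousand_le hL).1; linarith
  have hsub := sector_mono hεε₁
  obtain ⟨C₁, hC₁⟩ := hγ.size
  obtain ⟨C₂, hC₂⟩ := hγ.size_deriv
  refine ⟨hγ.holo.mono hsub, hγ.cont.mono (closure_mono hsub), hγ.zero, ?_, ?_,
    ⟨C₁, fun z hz => hC₁ z (hsub hz)⟩, ⟨C₂, fun z hz => hC₂ z (hsub hz)⟩⟩
  · rintro _ ⟨z, hz, rfl⟩
    have hU := mem_coneRegion_of_sector hR0 hε hz
    have h1 := h.map_curvePt hL hU
    have hs := (h.isPerturbedTranslation hF hL).small _ hU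
    rw [curvePt, neg_one_div_neg_one_div] at h1
    simp only
    rw [h1]
    exact ⟨_, (sector_step hz hs).1, rfl⟩
  · rintro _ ⟨z, hz, rfl⟩
    exact hγ.attracted _ ⟨z, hsub hz, rfl⟩

end

theorem image_backwardSaturation {F : ℂ × ℂ ≃ ℂ × ℂ} {S : Set (ℂ × ℂ)} (hS : Set.MapsTo F S S) :
    F '' backwardSaturation F S = backwardSaturation F S := by
  ext p
  constructor
  · rintro ⟨q, hq, rfl⟩
    obtain ⟨n, hn⟩ := Set.mem_iUnion.1 hq
    refine Set.mem_iUnion.2 ⟨n, ?_⟩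
    rw [Set.mem_preimage, ← Function.iterate_succ_apply, Function.iterate_succ_apply']
    exact hS hn
  · intro hp
    obtain ⟨n, hn⟩ := Set.mem_iUnion.1 hp
    refine ⟨F.symm p, Set.mem_iUnion.2 ⟨n + 1, ?_⟩, F.apply_symm_apply p⟩
    rw [Set.mem_preimage, Function.iterate_succ_apply, F.apply_symm_apply]
    exact hn

theorem mainTheorem7 (F : ℂ × ℂ ≃ ℂ × ℂ) (hF : IsDegenerateAutomorphism F) :
    (∃ ε₁ : ℝ, 0 < ε₁ ∧ ∃ γ : ℂ → ℂ, IsParabolicCurve F γ ε₁) ∧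
    ∀ (ε₁ : ℝ) (γ : ℂ → ℂ), 0 < ε₁ → IsParabolicCurve F γ ε₁ →
      ∃ ε₀ : ℝ, 0 < ε₀ ∧ ε₀ ≤ ε₁ ∧ ∀ ε : ℝ, 0 < ε → ε ≤ ε₀ →
        IsParabolicCurve F γ ε ∧
        F '' bigCurve F γ ε = bigCurve F γ ε ∧
        BigCurveBiholomorphicToPlane F γ ε ∧
        bigCurve F γ ε ⊆ frontier (basin F γ ε) := by
  refine ⟨exists_isParabolicCurve hF, fun ε₁ γ hε₁ hγ => ?_⟩
  obtain ⟨M, r, hL⟩ := exists_localBounds hF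
  obtain ⟨C, R, hR, hc⟩ := exists_curveControl hL hε₁ hγ
  have h := hc R le_rfl
  have hR0 : 0 < R := by have := (h.thousand_le hL).1; linarith
  have hle : 1 / (2 * R) ≤ ε₁ := by
    rw [one_div_le (by positivity) hε₁]; linarith
  refine ⟨1 / (2 * R), by positivity, hle, fun ε hε hεR => ?_⟩
  have hpar := h.isParabolicCurve_restrict hF.holo hL hεR (hεR.trans hle) hγ
  exact ⟨hpar, image_backwardSaturation hpar.invariant,
    h.biholomorphic hF.holo hF.holo_symm hL hε hεR,
    h.bigCurve_subset_frontier hF.holo_symm hL hεR hpar.invariant⟩
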